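/- **Setting.** Let $\mathbf C$ be a topological category: a category with finite limits together with a faithful functor $Z\colon\mathbf C\to\mathbf{Set}$ that has a fully faithful left adjoint $F$, such that $F$ commutes with finite limits and such that for every discrete object $D$ (i.e. $\mathrm{Hom}_{\mathbf C}(D,Y)=\mathrm{Hom}_{\mathbf{Set}}(ZD,ZY)$ for all $Y$) and all objects $X,Y$ the natural map $\mathrm{Hom}_{\mathbf C}(D\times X,Y)\to\mathrm{Hom}_{\mathbf{Set}}(ZD,\mathrm{Hom}_{\mathbf C}(X,Y))$ is bijective. A topologised monoid is a monoid object of $\mathbf C$. For a topologised monoid $G$, a $G$-module with $\mathbf C$-rigidification is an abelian group $A$ with an additive action of the monoid $ZG$, together with a contravariant functor $h_A$ on $\mathbf C$ whose values $h_A(X)$ are, functorially in $X$, subgroups of $\mathrm{Hom}_{\mathbf{Set}}(ZX,A)$, such that $h_A(F\bullet)=A$ for a singleton $\bullet$ and such that for every $f\in h_A(X)$ the map $(g,x)\mapsto g\cdot f(x)$ lies in $h_A(G\times X)$. A discrete object $D$ is $A$-pliant if $h_A(D\times X)=\mathrm{Hom}_{\mathbf{Set}}(ZD,h_A(X))$ for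 all $X$. Let $H^n(G,A)$ be the $n$-th cohomology of the complex of inhomogeneous cochains $X^n(G,A)=h_A(G^n)\subseteq\mathrm{Hom}_{\mathbf{Set}}((ZG)^n,A)$, $n\ge 0$, with boundary operator $$\partial f(x_1,\dots,x_{n+1})=x_1\cdot f(x_2,\dots,x_{n+1})+\sum_{i=1}^n(-1)^if(x_1,\dots,x_ix_{i+1},\dots,x_{n+1})+(-1)^{n+1}f(x_1,\dots,x_n),$$ and put $H^n(G,A)=0$ for $n<0$. **Proposition 11.18.** Let $D$ and $G$ be topologised monoids in $\mathbf C$ with $D$ discrete, and let $A$ be a $D\times G$-module with $\mathbf C$-rigidification such that $D$ is $A$-pliant. Suppose that, for some integer $r\ge 0$, the underlying monoid of $D$ is isomorphic to $\mathbb N_0^r$ or to $\mathbb Z^r$, and that $D$ acts trivially on $A$. Regard $A$ as a $G$-module via $G\to D\times G$, $g\mapsto(1,g)$. Then for every integer $n$ there is an isomorphism of abelian groups $$H^n(D\times G,A)\;\cong\;\bigoplus_{k=0}^r H^{n-k}(G,A)^{\oplus\binom rk}.$$ -/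

import Mathlib

open CategoryTheory MonoidalCategory CartesianMonoidalCategory Limits
open scoped MonObj DirectSum

universe a v u

namespace TopMonoidCohomology

/-! ### Topological categories -/

/-- A category admitting discrete objects: a category with finite limits together with a faithful
functor `Z` to sets (the "forgetful functor") and a fully faithful left adjoint `F` of `Z`. -/
class DiscreteObjectsCategory (C : Type u) [Category.{v} C] where
  /-- the forgetful functor -/
  Z : C ⥤ Type v
  /-- the functor sending a set to the corresponding discrete object -/
  F : Type v ⥤ C
  /-- `F` is left adjoint to `Z` -/
  adj : F ⊣ Z
  faithful_Z : Z.Faithful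
  full_F : F.Full
  faithful_F : F.Faithful
  hasFiniteLimits : HasFiniteLimits C

attribute [instance] DiscreteObjectsCategory.faithful_Z DiscreteObjectsCategory.full_F
  DiscreteObjectsCategory.faithful_F DiscreteObjectsCategory.hasFiniteLimits

section

variable {C : Type u} [Category.{v} C] [DiscreteObjectsCategory C]

/-- The underlying set of an object. -/
abbrev Pts (X : C) : Type v := DiscreteObjectsCategory.Z.obj X

/-- The underlying map of a morphism. -/
def mapPts {X Y : C} (φ : X ⟶ Y) : Pts X → Pts Y := fun x => DiscreteObjectsCategory.Z.map φ x

@[simp]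
lemma mapPts_comp {X Y W : C} (φ : X ⟶ Y) (ψ : Y ⟶ W) (x : Pts X) :
    mapPts (φ ≫ ψ) x = mapPts ψ (mapPts φ x) := by
  simp [mapPts]

@[simp]
lemma mapPts_id {X : C} (x : Pts X) : mapPts (𝟙 X) x = x := by
  simp [mapPts]

/-- An object `X` is discrete if `Hom(X, Y) = Hom_Set(Z X, Z Y)` for all objects `Y`. -/
def IsDiscrete (X : C) : Prop :=
  ∀ Y : C, Function.Bijective (mapPts : (X ⟶ Y) → (Pts X → Pts Y))

variable (C) in
/-- The discrete object on a singleton set. -/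
abbrev point : C := DiscreteObjectsCategory.F.obj (PUnit : Type v)

/-- `Z` is represented by the discrete singleton. -/
def ptsEquiv (X : C) : Pts X ≃ (point C ⟶ X) where
  toFun x := (DiscreteObjectsCategory.adj.homEquiv (PUnit : Type v) X).symm
    (TypeCat.ofHom fun _ => x)
  invFun φ := (DiscreteObjectsCategory.adj.homEquiv (PUnit : Type v) X φ) PUnit.unit
  left_inv x := by simp
  right_inv φ := by
    rw [Equiv.symm_apply_eq]
    ext ⟨⟩
    rfl

lemma ptsEquiv_naturality {X Y : C} (φ : X ⟶ Y) (x : Pts X) :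
    ptsEquiv Y (mapPts φ x) = ptsEquiv X x ≫ φ := by
  apply (ptsEquiv Y).symm.injective
  rw [Equiv.symm_apply_apply]
  conv_lhs => rw [← (ptsEquiv X).symm_apply_apply x]
  simp only [ptsEquiv, Equiv.coe_fn_symm_mk, mapPts]
  rw [Adjunction.homEquiv_naturality_right]
  rfl

section

variable [PreservesFiniteLimits (DiscreteObjectsCategory.F : Type v ⥤ C)]

/-- If `F` commutes with finite limits, the discrete singleton is a final object. -/
noncomputable def pointIsTerminal : IsTerminal (point C) :=
  IsTerminal.isTerminalObj DiscreteObjectsCategory.F (PUnit : Type v) Types.isTerminalPUnit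

/-- The constant morphism `X ⟶ Y` at a point of `Y`. -/
noncomputable def constHom (X : C) {Y : C} (y : Pts Y) : X ⟶ Y :=
  pointIsTerminal.from X ≫ ptsEquiv Y y

/-- For a point `d` of `D`, the morphism `X ⟶ D × X`, `x ↦ (d, x)`. -/
noncomputable def slice [CartesianMonoidalCategory C] {D : C} (d : Pts D) (X : C) : X ⟶ D ⊗ X :=
  lift (constHom X d) (𝟙 X)

end

end

/-- A topological category: a category admitting discrete objects such that `F` commutes with
finite limits and such that for every discrete object `D` and all `X`, `Y` the natural map
`Hom(D × X, Y) → Hom_Set(Z D, Hom(X, Y))` is bijective. -/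
class TopologicalCategory (C : Type u) [Category.{v} C] [CartesianMonoidalCategory C] extends
    DiscreteObjectsCategory C where
  preservesFiniteLimits_F : PreservesFiniteLimits (DiscreteObjectsCategory.F : Type v ⥤ C)
  bijective_curry : ∀ D X Y : C, IsDiscrete D →
    Function.Bijective fun (φ : D ⊗ X ⟶ Y) (d : Pts D) => slice d X ≫ φ

attribute [instance] TopologicalCategory.preservesFiniteLimits_F

variable {C : Type u} [Category.{v} C] [CartesianMonoidalCategory C] [TopologicalCategory C]

/-! ### Topologised monoids

A topologised monoid in `C` is a monoid object of `C`. -/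

/-- The underlying monoid of a topologised monoid. -/
instance ptsMonoid (G : C) [MonObj G] : Monoid (Pts G) := (ptsEquiv G).monoid

lemma ptsEquiv_mul {G : C} [MonObj G] (x y : Pts G) :
    ptsEquiv G (x * y) = ptsEquiv G x * ptsEquiv G y := by
  change ptsEquiv G ((ptsEquiv G).symm (ptsEquiv G x * ptsEquiv G y)) = _
  rw [Equiv.apply_symm_apply]

lemma ptsEquiv_one {G : C} [MonObj G] : ptsEquiv G (1 : Pts G) = 1 := by
  change ptsEquiv G ((ptsEquiv G).symm _) = _
  rw [Equiv.apply_symm_apply]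

/-- The multiplication of the underlying monoid is the map underlying `μ : G × G ⟶ G`. -/
lemma mapPts_mul {G : C} [MonObj G] (z : Pts (G ⊗ G)) :
    mapPts MonObj.mul z = mapPts (fst G G) z * mapPts (snd G G) z := by
  apply (ptsEquiv G).injective
  rw [ptsEquiv_mul, ptsEquiv_naturality, ptsEquiv_naturality, ptsEquiv_naturality, Hom.mul_def,
    ← comp_lift, lift_fst_snd, Category.comp_id]

lemma mapPts_lift_mul {G X : C} [MonObj G] (f g : X ⟶ G) (x : Pts X) :
    mapPts (lift f g ≫ MonObj.mul) x = mapPts f x * mapPts g x := by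
  rw [mapPts_comp, mapPts_mul, ← mapPts_comp, ← mapPts_comp, lift_fst, lift_snd]

/-- The monoid homomorphism underlying a morphism of topologised monoids. -/
def mapPtsHom {H G : C} [MonObj H] [MonObj G] (φ : H ⟶ G) [IsMonHom φ] : Pts H →* Pts G where
  toFun := mapPts φ
  map_one' := by
    apply (ptsEquiv G).injective
    rw [ptsEquiv_naturality, ptsEquiv_one, ptsEquiv_one, MonObj.one_comp]
  map_mul' x y := by
    apply (ptsEquiv G).injective
    rw [ptsEquiv_naturality, ptsEquiv_mul, ptsEquiv_mul, ptsEquiv_naturality,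
      ptsEquiv_naturality, MonObj.mul_comp]

/-- The morphism `D ⟶ D × G`, `d ↦ (d, 1)`. -/
def inlHom (D G : C) [MonObj D] [MonObj G] : D ⟶ D ⊗ G := lift (𝟙 D) (toUnit D ≫ MonObj.one)

/-- The morphism `G ⟶ D × G`, `g ↦ (1, g)`. -/
def inrHom (D G : C) [MonObj D] [MonObj G] : G ⟶ D ⊗ G := lift (toUnit G ≫ MonObj.one) (𝟙 G)

instance [BraidedCategory C] (D G : C) [MonObj D] [MonObj G] : IsMonHom (inlHom D G) := by
  unfold inlHom; infer_instance

instance [BraidedCategory C] (D G : C) [MonObj D] [MonObj G] : IsMonHom (inrHom D G) := by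
  unfold inrHom; infer_instance

/-! ### Modules with rigidification -/

/-- A `G`-module with `C`-rigidification: an abelian group `A` with an additive action of the
monoid `Z G`, together with a contravariant functor `h` on `C` whose values `h X` are subgroups of
the group of all maps `Z X → A`, such that `h` of the discrete singleton consists of all maps, and
such that for `f ∈ h X` the map `(g, x) ↦ g • f x` belongs to `h (G × X)`. -/
structure RigidModule (G : C) [MonObj G] where
  /-- the underlying set -/
  carrier : Type a
  [addCommGroup : AddCommGroup carrier]
  /-- the action of the underlying monoid of `G` -/
  act : Pts G →* AddMonoid.End carrier
  /-- the admissible maps from an object of `C` to the module -/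
  h (X : C) : AddSubgroup (Pts X → carrier)
  comp_mem {X Y : C} (φ : X ⟶ Y) {f : Pts Y → carrier} (hf : f ∈ h Y) :
    (fun x => f (mapPts φ x)) ∈ h X
  h_point : h (point C) = ⊤
  act_mem {X : C} {f : Pts X → carrier} (hf : f ∈ h X) :
    (fun z : Pts (G ⊗ X) => act (mapPts (fst G X) z) (f (mapPts (snd G X) z))) ∈ h (G ⊗ X)

attribute [instance] RigidModule.addCommGroup

namespace RigidModule

/-- An object `D` is `A`-pliant if `h (D × X) = Hom_Set(Z D, h X)` for all `X`, i.e. if a map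
`f` on `D × X` is admissible exactly when all the maps `x ↦ f (d, x)` are. (This notion is
applied to discrete `D`.) -/
def IsPliant {G : C} [MonObj G] (A : RigidModule.{a} G) (D : C) : Prop :=
  ∀ (X : C) (f : Pts (D ⊗ X) → A.carrier),
    f ∈ A.h (D ⊗ X) ↔ ∀ d : Pts D, (fun x => f (mapPts (slice d X) x)) ∈ A.h X

/-- Restriction of a module along a morphism of topologised monoids. -/
def restrict {H G : C} [MonObj H] [MonObj G] (A : RigidModule.{a} G) (φ : H ⟶ G) [IsMonHom φ] :
    RigidModule.{a} H where
  carrier := A.carrier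
  act := A.act.comp (mapPtsHom φ)
  h := A.h
  comp_mem := A.comp_mem
  h_point := A.h_point
  act_mem {X f} hf := by
    have := A.comp_mem (φ ▷ X) (A.act_mem hf)
    simp only [← mapPts_comp, whiskerRight_fst, whiskerRight_snd] at this
    simp only [mapPts_comp] at this
    exact this

end RigidModule

/-! ### Inhomogeneous cochains of an abstract monoid -/

section Abstract

variable {M : Type*} [Monoid M] {B : Type*} [AddCommGroup B]

/-- The boundary operator on inhomogeneous cochains,
`(∂f)(x₁, …, xₙ₊₁) = x₁ • f(x₂, …, xₙ₊₁) + ∑ᵢ (-1)ⁱ f(x₁, …, xᵢ xᵢ₊₁, …, xₙ₊₁)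
  + (-1)ⁿ⁺¹ f(x₁, …, xₙ)`.
The sum below runs over `i - 1 = j = 0, …, n`; since `Fin.contractNth j` multiplies the entries
with (zero-based) indices `j` and `j + 1` for `j < n` and drops the last entry for `j = n`, the
summand for `j = n` is the last term of the formula. -/
def bd (ρ : M →* AddMonoid.End B) (n : ℕ) :
    ((Fin n → M) → B) →+ ((Fin (n + 1) → M) → B) where
  toFun f x := ρ (x 0) (f fun i => x i.succ) +
    ∑ j : Fin (n + 1), (-1 : ℤ) ^ ((j : ℕ) + 1) • f (Fin.contractNth j (· * ·) x)
  map_zero' := by ext x; simp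
  map_add' f g := by
    ext x
    simp only [Pi.add_apply, map_add, smul_add, Finset.sum_add_distrib]
    abel

/-- The summands of the boundary operator. -/
def face (ρ : M →* AddMonoid.End B) {n : ℕ} (i : Fin (n + 2)) (f : (Fin n → M) → B)
    (x : Fin (n + 1) → M) : B :=
  Fin.cases (ρ (x 0) (f fun i => x i.succ)) (fun j => f (Fin.contractNth j (· * ·) x)) i

lemma bd_eq_sum (ρ : M →* AddMonoid.End B) (n : ℕ) (f : (Fin n → M) → B) (x : Fin (n + 1) → M) :
    bd ρ n f x = ∑ i : Fin (n + 2), (-1 : ℤ) ^ (i : ℕ) • face ρ i f x := by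
  rw [Fin.sum_univ_succ]
  simp [bd, face]

lemma contractNth_contractNth {n : ℕ} (i j : Fin (n + 1)) (hij : i ≤ j) (x : Fin (n + 2) → M) :
    Fin.contractNth i (· * ·) (Fin.contractNth j.succ (· * ·) x) =
      Fin.contractNth j (· * ·) (Fin.contractNth i.castSucc (· * ·) x) := by
  ext k
  have : (i : ℕ) ≤ j := hij
  simp only [Fin.contractNth, Fin.val_succ, Fin.val_castSucc]
  split_ifs <;> first | rfl | omega | (simp only [mul_assoc]; rfl)

lemma face_face (ρ : M →* AddMonoid.End B) {n : ℕ} (i j : Fin (n + 2)) (hij : i ≤ j)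
    (f : (Fin n → M) → B) (x : Fin (n + 2) → M) :
    face ρ j.succ (face ρ i f) x = face ρ i.castSucc (face ρ j f) x := by
  induction i using Fin.cases with
  | zero =>
    induction j using Fin.cases with
    | zero =>
      have h : (fun i : Fin n => Fin.contractNth (0 : Fin (n + 2)) (· * ·) x i.succ) =
          fun i => x i.succ.succ := by
        ext i
        simp [Fin.contractNth]
      simp only [face, Fin.cases_succ, Fin.cases_zero, Fin.castSucc_zero]
      rw [h]
      simp [Fin.contractNth]
    | succ j =>
      have h : (fun i : Fin n => Fin.contractNth j.succ (· * ·) x i.succ) =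
          Fin.contractNth j (· * ·) fun i => x i.succ := by
        ext i
        simp [Fin.contractNth]
      simp only [face, Fin.cases_succ, Fin.cases_zero, Fin.castSucc_zero]
      rw [h]
      simp [Fin.contractNth]
  | succ i =>
    induction j using Fin.cases with
    | zero => simp at hij
    | succ j =>
      simp only [face, Fin.cases_succ, Fin.castSucc_succ]
      rw [contractNth_contractNth i j (Fin.succ_le_succ_iff.mp hij)]

lemma bd_bd (ρ : M →* AddMonoid.End B) (n : ℕ) (f : (Fin n → M) → B) :
    bd ρ (n + 1) (bd ρ n f) = 0 := by
  ext x
  have key : ∀ i : Fin (n + 3), face ρ i (bd ρ n f) x =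
      ∑ j : Fin (n + 2), (-1 : ℤ) ^ (j : ℕ) • face ρ i (face ρ j f) x := by
    intro i
    induction i using Fin.cases with
    | zero => simp only [face, Fin.cases_zero, bd_eq_sum, map_sum, map_zsmul]
    | succ i => simp only [face, Fin.cases_succ, bd_eq_sum]
  rw [bd_eq_sum]
  simp only [key, Finset.smul_sum, smul_smul, Pi.zero_apply]
  rw [← Finset.sum_product', Finset.univ_product_univ]
  let P := Fin (n + 3) × Fin (n + 2)
  let S : Finset P := {ij : P | (ij.1 : ℕ) ≤ (ij.2 : ℕ)}
  rw [← Finset.sum_add_sum_compl S, ← eq_neg_iff_add_eq_zero, ← Finset.sum_neg_distrib]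
  let φ : ∀ ij : P, ij ∈ S → P := fun ij hij =>
    (ij.2.succ, Fin.castLT ij.1 (lt_of_le_of_lt (Finset.mem_filter.mp hij).right (Fin.is_lt ij.2)))
  apply Finset.sum_bij φ
  · intro ij hij
    simp_rw [S, φ, Finset.compl_filter, Finset.mem_filter_univ, Fin.val_succ,
      Fin.val_castLT] at hij ⊢
    omega
  · rintro ⟨i, j⟩ hij ⟨i', j'⟩ hij' h
    have h1 : j = j' := Fin.succ_injective _ (congrArg Prod.fst h)
    have h2 : (i : ℕ) = i' := congrArg (fun p : P => (p.2 : ℕ)) h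
    exact Prod.ext (Fin.ext h2) h1
  · rintro ⟨i', j'⟩ hij'
    simp_rw [S, Finset.compl_filter, Finset.mem_filter_univ, not_le] at hij'
    refine ⟨(Fin.castSucc j', i'.pred ?_), ?_, ?_⟩
    · rintro rfl
      simp at hij'
    · simp only [S, Finset.mem_filter_univ, Fin.val_castSucc, Fin.val_pred]
      omega
    · simp [φ]
  · rintro ⟨i, j⟩ hij
    have hij' : (i : ℕ) ≤ j := (Finset.mem_filter.mp hij).right
    have hlt : (i : ℕ) < n + 2 := lt_of_le_of_lt hij' j.is_lt
    have h := face_face ρ (i.castLT hlt) j hij' f x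
    rw [Fin.castSucc_castLT] at h
    simp only [φ, Fin.val_succ, Fin.val_castLT]
    rw [h, ← neg_smul]
    congr 1
    ring

end Abstract

/-! ### Cohomology of topologised monoids -/

namespace RigidModule

variable {G : C} [MonObj G] (A : RigidModule.{a} G)

/-- The point of `(Z G)ⁿ` underlying a point of `Gⁿ`. -/
noncomputable def coords {n : ℕ} (z : Pts (∏ᶜ fun _ : Fin n => G)) : Fin n → Pts G :=
  fun i => mapPts (Pi.π (fun _ : Fin n => G) i) z

/-- The inhomogeneous `n`-cochains `h (Gⁿ)`, regarded as maps `(Z G)ⁿ → A`. -/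
def cochains (n : ℕ) : AddSubgroup ((Fin n → Pts G) → A.carrier) where
  carrier := {f | (fun z => f (coords z)) ∈ A.h (∏ᶜ fun _ : Fin n => G)}
  zero_mem' := (A.h _).zero_mem
  add_mem' := (A.h _).add_mem
  neg_mem' := (A.h _).neg_mem

lemma bd_mem {n : ℕ} {f : (Fin n → Pts G) → A.carrier} (hf : f ∈ A.cochains n) :
    bd A.act n f ∈ A.cochains (n + 1) := by
  have h0 := A.comp_mem (lift (Pi.π (fun _ : Fin (n + 1) => G) 0)
    (Pi.lift fun i : Fin n => Pi.π (fun _ : Fin (n + 1) => G) i.succ)) (A.act_mem hf)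
  have h1 : ∀ j : Fin (n + 1), (fun z : Pts (∏ᶜ fun _ : Fin (n + 1) => G) =>
      f (Fin.contractNth j (· * ·) (coords z))) ∈ A.h (∏ᶜ fun _ : Fin (n + 1) => G) := by
    intro j
    have := A.comp_mem (Pi.lift fun k : Fin n => Fin.contractNth j
      (fun p q => lift p q ≫ MonObj.mul) (Pi.π (fun _ : Fin (n + 1) => G)) k) hf
    convert this using 3 with z
    ext k
    simp only [coords, ← mapPts_comp, Pi.lift_π, Fin.contractNth]
    split_ifs
    · rfl
    · rw [mapPts_lift_mul]
    · rfl
  have h2 : (fun z : Pts (∏ᶜ fun _ : Fin (n + 1) => G) => bd A.act n f (coords z)) =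
      (fun z => A.act (coords z 0) (f fun i => coords z i.succ)) +
        ∑ j : Fin (n + 1), (-1 : ℤ) ^ ((j : ℕ) + 1) •
          fun z => f (Fin.contractNth j (· * ·) (coords z)) := by
    ext z
    simp [bd, Finset.sum_apply]
  change (fun z => bd A.act n f (coords z)) ∈ A.h _
  rw [h2]
  refine add_mem ?_ (sum_mem fun j _ => zsmul_mem (h1 j) _)
  convert h0 using 2 with z
  simp only [← mapPts_comp, lift_fst, lift_snd]
  have h3 : (fun i : Fin n => coords z i.succ) =
      coords (mapPts (Pi.lift fun i : Fin n => Pi.π (fun _ : Fin (n + 1) => G) i.succ) z) := by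
    ext i
    simp only [coords, ← mapPts_comp, Pi.lift_π]
  rw [h3]
  rfl

/-- The boundary operator `h (Gⁿ) → h (Gⁿ⁺¹)`. -/
def bdCochains (n : ℕ) : A.cochains n →+ A.cochains (n + 1) :=
  ((bd A.act n).comp (A.cochains n).subtype).codRestrict (A.cochains (n + 1))
    fun f => A.bd_mem f.2

/-- The complex of inhomogeneous cochains of `G` with coefficients in `A`. -/
noncomputable def complex : CochainComplex AddCommGrpCat.{max a v} ℕ :=
  CochainComplex.of (fun n => AddCommGrpCat.of (A.cochains n))
    (fun n => AddCommGrpCat.ofHom (A.bdCochains n)) fun n => by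
      ext f : 2
      exact Subtype.ext (bd_bd A.act n f.1)

/-- The cohomology `Hⁿ(G, A)`, for `n` an arbitrary integer; it is zero for `n < 0`. -/
noncomputable def cohomology : ℤ → AddCommGrpCat.{max a v}
  | Int.ofNat n => A.complex.homology n
  | Int.negSucc _ => AddCommGrpCat.of PUnit

end RigidModule

end TopMonoidCohomology

namespace TopMonoidCohomology

/-! ### Formal properties of the boundary operator -/

section Boundary

variable {P Q : Type*} [Monoid P] [Monoid Q] {B B' : Type*} [AddCommGroup B] [AddCommGroup B']

/-! By pliancy, a cochain of $D\times G$ is admissible exactly when fixing its $D$-coordinates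
always leaves an admissible cochain of $G$ (`mem_cochains_tensor_iff`). The statement thus becomes
one about systems of cochains of a product $M\times P$ of abstract monoids, with $M$ acting
trivially and no condition in the $M$-direction.

Let $M$ be $\mathbb N_0$ or $\mathbb Z$ with generator $t$. The sequence $0\to B\to
\mathrm{Map}(M,B)\to \mathrm{Map}(M,B)\to 0$, whose second map is
$\varphi\mapsto\varphi(t\,\cdot)-\varphi$, is exact, even on admissible cochains
(`shortExact_of_isLine`). A Shapiro-type statement identifies $H^n(M\times P,\mathrm{Map}(M,B))$
with $H^n(P,B)$. It is proved by an explicit prism homotopy (`prismOp_bd`, `coindHomotopy`), since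
only the given cochains are available. Under this identification, inflation followed by the constant
embedding is the inverse of restriction and evaluation. So every class of the middle term comes from
constants, the difference map is zero on cohomology, and the long exact sequence splits:
$H^n(M\times P,B)\cong H^n(P,B)\oplus H^{n-1}(P,B)$ (`nonempty_cohomology_prod_addEquiv`). Applying
this $r$ times gives the binomial coefficients by Pascal's rule. -/

lemma map_contractNth {n : ℕ} (α : Q →* P) (j : Fin (n + 1)) (x : Fin (n + 1) → Q) :
    (fun i => α (Fin.contractNth j (· * ·) x i)) =
      Fin.contractNth j (· * ·) (fun i => α (x i)) := by
  ext i
  simp only [Fin.contractNth]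
  split_ifs <;> simp

/-- The boundary operator commutes with maps of coefficients and of monoids. -/
lemma bd_map (ρ : P →* AddMonoid.End B) (σ : Q →* AddMonoid.End B') (α : Q →* P) (g : B →+ B')
    (h : ∀ q b, g (ρ (α q) b) = σ q (g b)) (n : ℕ) (f : (Fin n → P) → B) (x : Fin (n + 1) → Q) :
    bd σ n (fun y => g (f fun i => α (y i))) x = g (bd ρ n f fun i => α (x i)) := by
  simp [bd, h, map_contractNth]

variable (P B) in
/-- The action of a monoid on maps out of it by right translation. -/
def translate : P →* AddMonoid.End (P → B) where
  toFun p :=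
    { toFun := fun φ q => φ (q * p)
      map_zero' := rfl
      map_add' := fun _ _ => rfl }
  map_one' := by
    ext φ q
    exact congrArg φ (mul_one q)
  map_mul' p q := by
    ext φ r
    exact congrArg φ (mul_assoc r p q).symm

@[simp]
lemma translate_apply (p : P) (φ : P → B) (q : P) : translate P B p φ q = φ (q * p) := rfl

lemma bd_zero_apply (ρ : P →* AddMonoid.End B) (f : (Fin 0 → P) → B) (x : Fin 1 → P)
    (z : Fin 0 → P) : bd ρ 0 f x = ρ (x 0) (f z) - f z := by
  simp [bd, sub_eq_add_neg, Subsingleton.elim _ z]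

lemma contractNth_zero_cons {n : ℕ} (y : P) (x : Fin (n + 1) → P) :
    Fin.contractNth 0 (· * ·) (Fin.cons y x : Fin (n + 2) → P) =
      (Fin.cons (y * x 0) fun i => x i.succ : Fin (n + 1) → P) := by
  ext i
  induction i using Fin.cases with
  | zero => simp [Fin.contractNth]
  | succ i => simp [Fin.contractNth]

lemma contractNth_succ_cons {n : ℕ} (j : Fin (n + 1)) (y : P) (x : Fin (n + 1) → P) :
    Fin.contractNth j.succ (· * ·) (Fin.cons y x : Fin (n + 2) → P) =
      (Fin.cons y (Fin.contractNth j (· * ·) x) : Fin (n + 1) → P) := by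
  ext i
  induction i using Fin.cases with
  | zero => simp [Fin.contractNth]
  | succ i => simp [Fin.contractNth]

/-- Currying the first variable of a cochain. -/
lemma bd_cons (ρ : P →* AddMonoid.End B) (n : ℕ) (f : (Fin (n + 1) → P) → B) (y : P)
    (x : Fin (n + 1) → P) :
    bd ρ (n + 1) f (Fin.cons y x) =
      ρ y (f x) - bd (translate P B) n (fun z p => f (Fin.cons p z)) x y := by
  simp only [bd, AddMonoidHom.coe_mk, ZeroHom.coe_mk]
  -- The face multiplying `y` with `x 0` becomes the action term of the curried boundary; all other
  -- faces shift by one index. This accounts for the minus sign.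
  rw [Fin.sum_univ_succ, contractNth_zero_cons]
  simp only [contractNth_succ_cons, Fin.cons_zero, Fin.cons_succ, Pi.add_apply, Finset.sum_apply,
    Pi.smul_apply, translate_apply, Fin.val_zero, zero_add, pow_one, neg_smul, one_smul,
    Fin.val_succ]
  rw [sub_eq_add_neg, neg_add, ← Finset.sum_neg_distrib]
  congr 2
  refine Finset.sum_congr rfl fun j _ => ?_
  rw [← neg_smul]
  congr 1
  ring

end Boundary

/-! ### The prism homotopy -/

section Prism

lemma cons_one_snd {M P : Type*} [Monoid M] {n : ℕ} (y : M × P) (z : Fin n → M × P) :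
    (fun i => ((1 : M), ((Fin.cons y z : Fin (n + 1) → M × P) i).2)) =
      (Fin.cons (1, y.2) fun i => (1, (z i).2) : Fin (n + 1) → M × P) := by
  ext i <;> induction i using Fin.cases <;> rfl

variable {M P : Type*} [Monoid M] [Monoid P] {B : Type*} [AddCommGroup B]

variable (M) in
/-- The action of `M × P` on the maps from `M` to a `P`-module, where `M` acts by right
translation. -/
def coindAct (ρ : P →* AddMonoid.End B) : M × P →* AddMonoid.End (M → B) where
  toFun y :=
    { toFun := fun φ m => ρ y.2 (φ (m * y.1))
      map_zero' := by ext; simp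
      map_add' := fun _ _ => by ext; simp }
  map_one' := by
    ext φ m
    change ρ 1 (φ (m * 1)) = φ m
    rw [map_one, mul_one, AddMonoid.End.coe_one, id]
  map_mul' p q := by
    ext φ m
    change ρ (p.2 * q.2) (φ (m * (p.1 * q.1))) = ρ p.2 (ρ q.2 (φ (m * p.1 * q.1)))
    rw [map_mul, mul_assoc]
    rfl

@[simp]
lemma coindAct_apply (ρ : P →* AddMonoid.End B) (y : M × P) (φ : M → B) (m : M) :
    coindAct M ρ y φ m = ρ y.2 (φ (m * y.1)) := rfl

/-- The simplices of the prism joining `(1, p₁), …, (1, pₙ)` to `(m₁, p₁), …, (mₙ, pₙ)`. -/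
def prism : (n : ℕ) → Fin (n + 1) → (Fin n → M × P) → M → Fin (n + 1) → M × P
  | 0, _, _, m => fun _ => (m, 1)
  | n + 1, j, x, m => Fin.cases (Fin.cons (m, 1) x)
      (fun j => Fin.cons (1, (x 0).2) (prism n j (fun i => x i.succ) (m * (x 0).1))) j

/-- The prism operator. -/
def prismOp (n : ℕ) (f : (Fin (n + 1) → M × P) → B) (x : Fin n → M × P) (m : M) : B :=
  ∑ j : Fin (n + 1), (-1 : ℤ) ^ (j : ℕ) • f (prism n j x m)

lemma prismOp_map {B' : Type*} [AddCommGroup B'] (g : B →+ B') (n : ℕ)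
    (f : (Fin (n + 1) → M × P) → B) (x : Fin n → M × P) (m : M) :
    prismOp n (fun y => g (f y)) x m = g (prismOp n f x m) := by
  simp [prismOp]

lemma prismOp_sub (n : ℕ) (f g : (Fin (n + 1) → M × P) → B) (x : Fin n → M × P) (m : M) :
    prismOp n (fun y => f y - g y) x m = prismOp n f x m - prismOp n g x m := by
  simp [prismOp, smul_sub]

lemma prismOp_zero (f : (Fin 1 → M × P) → B) (x : Fin 0 → M × P) (m : M) :
    prismOp 0 f x m = f fun _ => (m, 1) := by
  simp [prismOp, prism]

/-- Unfolded, the operator is $\sum_j(-1)^jf((1,p_1),\dots,(1,p_j),(m\,m_1\cdots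
m_j,1),x_{j+1},\dots,x_n)$ with $x_i=(m_i,p_i)$. All summands with $j>0$ begin with $(1,p_1)$, which
gives a recursion on the curried cochain. -/
lemma prismOp_cons (n : ℕ) (f : (Fin (n + 2) → M × P) → B) (y : M × P) (x : Fin n → M × P)
    (m : M) :
    prismOp (n + 1) f (Fin.cons y x) m = f (Fin.cons (m, 1) (Fin.cons y x)) -
      prismOp n (fun z p => f (Fin.cons (1, p) z)) x (m * y.1) y.2 := by
  rw [prismOp, Fin.sum_univ_succ]
  simp only [prism, Fin.cases_zero, Fin.cases_succ, Fin.cons_zero, Fin.cons_succ, prismOp,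
    Fin.val_zero, pow_zero, one_smul, Fin.val_succ, pow_succ, mul_neg_one, neg_smul,
    Finset.sum_neg_distrib, Finset.sum_apply, Pi.smul_apply, sub_eq_add_neg]

lemma bd_coindAct_cons (ρ : P →* AddMonoid.End B) (n : ℕ) (F : (Fin (n + 1) → M × P) → M → B)
    (y : M × P) (x : Fin (n + 1) → M × P) (m : M) :
    bd (coindAct M ρ) (n + 1) F (Fin.cons y x) m = ρ y.2 (F x (m * y.1)) -
      bd (translate (M × P) B) n (fun z y => F (Fin.cons y z) m) x y := by
  rw [bd_cons, Pi.sub_apply, coindAct_apply]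
  congr 1
  exact (congr_fun (bd_map (translate (M × P) (M → B)) (translate (M × P) B) (MonoidHom.id _)
    { toFun := fun φ y => φ y m, map_zero' := rfl, map_add' := fun _ _ => rfl }
    (fun _ _ => rfl) n (fun z y => F (Fin.cons y z)) x) y).symm

/-- Left multiplication by `m` commutes with right translation, so uncurrying from
$\mathrm{Map}(M,\mathrm{Map}(P,B))$ to $\mathrm{Map}(M\times P,B)$ after this shift is equivariant.
-/
lemma bd_translate_eq (m : M) (n : ℕ) (F : (Fin n → M × P) → M → P → B)
    (x : Fin (n + 1) → M × P) (y : M × P) :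
    bd (translate (M × P) B) n (fun z y => F z (m * y.1) y.2) x y =
      bd (coindAct M (translate P B)) n F x (m * y.1) y.2 :=
  congr_fun (bd_map (coindAct M (translate P B)) (translate (M × P) B) (MonoidHom.id _)
    { toFun := fun φ y => φ (m * y.1) y.2, map_zero' := rfl, map_add' := fun _ _ => rfl }
    (fun _ _ => by ext; simp [mul_assoc]) n F x) y

lemma prismOp_bd_zero (ρ : P →* AddMonoid.End B) (F : (Fin 0 → M × P) → M → B)
    (x : Fin 0 → M × P) (m : M) :
    prismOp 0 (fun y => bd (coindAct M ρ) 0 F y 1) x m = F x m - F (fun i => (1, (x i).2)) 1 := by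
  simp [prismOp, bd, prism, Subsingleton.elim _ x, sub_eq_add_neg]

/-- Peels the first variable off both the prism operator and the boundary. What remains involves the
curried cochain `fun z m p => F (Fin.cons (m, p) z) 1`, of one degree less and with coefficients
coinduced from `P → B`, which is what the induction needs. -/
lemma prismOp_bd_aux (ρ : P →* AddMonoid.End B) (n : ℕ) (F : (Fin (n + 1) → M × P) → M → B)
    (y : M × P) (x : Fin n → M × P) (m : M) :
    prismOp (n + 1) (fun z => bd (coindAct M ρ) (n + 1) F z 1) (Fin.cons y x) m =
      F (Fin.cons y x) m -
        bd (coindAct M (translate P B)) n (fun z m p => F (Fin.cons (m, p) z) 1)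
          (Fin.cons y x) m 1 -
        ρ y.2 (prismOp n (fun z => F z 1) x (m * y.1)) +
        prismOp n (fun z => bd (coindAct M (translate P B)) n
          (fun z m p => F (Fin.cons (m, p) z) 1) z 1) x (m * y.1) y.2 := by
  have key : ∀ (y : M × P) (z : Fin (n + 1) → M × P),
      bd (coindAct M ρ) (n + 1) F (Fin.cons y z) 1 = ρ y.2 (F z y.1) -
        bd (coindAct M (translate P B)) n (fun z m p => F (Fin.cons (m, p) z) 1) z y.1 y.2 := by
    intro y z
    have := bd_translate_eq 1 n (fun z (m : M) (p : P) => F (Fin.cons (m, p) z) 1) z y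
    simp only [one_mul] at this
    rw [bd_coindAct_cons, one_mul, ← this]
  have h1 := congr_fun (prismOp_sub n (fun z p => ρ p (F z 1)) (fun z => bd (coindAct M
    (translate P B)) n (fun z m p => F (Fin.cons (m, p) z) 1) z 1) x (m * y.1)) y.2
  have h2 := prismOp_map (Pi.evalAddMonoidHom (fun _ : P => B) y.2) n
    (fun z p => ρ p (F z 1)) x (m * y.1)
  simp only [Pi.evalAddMonoidHom_apply] at h2
  have h4 : prismOp n (fun z => ρ y.2 (F z 1)) x (m * y.1) =
      ρ y.2 (prismOp n (fun z => F z 1) x (m * y.1)) :=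
    prismOp_map (ρ y.2) n (fun z => F z 1) x (m * y.1)
  rw [Pi.sub_apply, ← h2, h4] at h1
  have h3 : (fun (z : Fin (n + 1) → M × P) p =>
      bd (coindAct M ρ) (n + 1) F (Fin.cons (1, p) z) 1) = fun z => (fun p => ρ p (F z 1)) -
        bd (coindAct M (translate P B)) n (fun z m p => F (Fin.cons (m, p) z) 1) z 1 := by
    ext z p
    exact key (1, p) z
  rw [prismOp_cons, key, h3, h1, map_one, AddMonoid.End.coe_one, id]
  abel

end Prism

section PrismHomotopy

variable {M P : Type v} [Monoid M] [Monoid P]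

/-- Induction by dimension shifting: the first variable is absorbed into the coefficients. The
universe `max a v` is stable under passing from `B` to `P → B`, which lets the induction generalize
over `B`. -/
lemma prismOp_bd_of_univ {B : Type max a v} [AddCommGroup B] (ρ : P →* AddMonoid.End B) (n : ℕ)
    (F : (Fin (n + 1) → M × P) → M → B) (x : Fin (n + 1) → M × P) (m : M) :
    prismOp (n + 1) (fun y => bd (coindAct M ρ) (n + 1) F y 1) x m +
      bd (coindAct M ρ) n (prismOp n fun y => F y 1) x m =
      F x m - F (fun i => (1, (x i).2)) 1 := by
  induction n generalizing B m with
  | zero =>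
    rw [← Fin.cons_self_tail x]
    generalize x 0 = y, Fin.tail x = x
    -- The curried cochain has degree zero, where the homotopy formula has no second summand.
    have h := congr_fun (prismOp_bd_zero (translate P B) (fun z m p => F (Fin.cons (m, p) z) 1) x
      (m * y.1)) y.2
    have h1 : (Fin.cons (m, 1) x : Fin 1 → M × P) = fun _ => (m, 1) := by
      funext i
      induction i using Fin.cases with
      | zero => rfl
      | succ i => exact i.elim0
    rw [prismOp_bd_aux, cons_one_snd, h, bd_zero_apply _ _ _ x, bd_zero_apply _ _ _ x]
    simp only [coindAct_apply, Pi.sub_apply, translate_apply, one_mul, prismOp_zero,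
      Fin.cons_zero, h1]
    abel
  | succ n ih =>
    rw [← Fin.cons_self_tail x]
    generalize x 0 = y, Fin.tail x = x
    -- The induction hypothesis for the curried cochain, at the base point shifted by `y.1`.
    have h := congr_fun (ih (translate P B) (fun z m p => F (Fin.cons (m, p) z) 1) x (m * y.1)) y.2
    have h1 : (fun z y => prismOp (n + 1) (fun y => F y 1) (Fin.cons y z) m) =
      (fun (z : Fin n → M × P) (y : M × P) => F (Fin.cons (m, 1) (Fin.cons y z)) 1) -
      (fun z y => prismOp n (fun z p => F (Fin.cons (1, p) z) 1) z (m * y.1) y.2) := by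
      ext z y
      exact prismOp_cons n _ y z m
    have h2 := congr_fun (bd_coindAct_cons (translate P B) n
      (fun z m p => F (Fin.cons (m, p) z) 1) y x m) 1
    have h3 := congr_fun (bd_map (translate (M × P) (P → B)) (translate (M × P) B)
      (MonoidHom.id _) { toFun := fun φ y => φ y 1, map_zero' := rfl, map_add' := fun _ _ => rfl }
      (fun _ _ => rfl) n (fun z y p => F (Fin.cons (m, p) (Fin.cons y z)) 1) x) y
    simp only [AddMonoidHom.coe_mk, ZeroHom.coe_mk, MonoidHom.id_apply] at h3
    simp only [Pi.sub_apply, translate_apply, one_mul] at h2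
    rw [← h3] at h2
    rw [prismOp_bd_aux, cons_one_snd, h2, bd_coindAct_cons, h1, map_sub, Pi.sub_apply, Pi.sub_apply,
      bd_translate_eq m n (prismOp n (fun z p => F (Fin.cons (1, p) z) 1))]
    rw [Pi.add_apply, Pi.sub_apply, ← eq_sub_iff_add_eq] at h
    rw [h]
    abel

/-- The prism operator is a homotopy between the identity and the projection to the cochains
which only depend on the second factor. -/
lemma prismOp_bd {B : Type a} [AddCommGroup B] (ρ : P →* AddMonoid.End B) (n : ℕ)
    (F : (Fin (n + 1) → M × P) → M → B) (x : Fin (n + 1) → M × P) (m : M) :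
    prismOp (n + 1) (fun y => bd (coindAct M ρ) (n + 1) F y 1) x m +
      bd (coindAct M ρ) n (prismOp n fun y => F y 1) x m =
      F x m - F (fun i => (1, (x i).2)) 1 := by
  let ρ' : P →* AddMonoid.End (PUnit.{v + 1} → B) :=
    { toFun := fun p =>
        { toFun := fun φ u => ρ p (φ u)
          map_zero' := by ext; simp
          map_add' := fun _ _ => by ext; simp }
      map_one' := by
        ext φ u
        change ρ 1 (φ u) = φ u
        rw [map_one, AddMonoid.End.coe_one, id]
      map_mul' := fun p q => by
        ext φ u
        change ρ (p * q) (φ u) = ρ p (ρ q (φ u))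
        rw [map_mul]
        rfl }
  let g : (M → PUnit.{v + 1} → B) →+ (M → B) :=
    { toFun := fun φ m => φ m PUnit.unit, map_zero' := rfl, map_add' := fun _ _ => rfl }
  have hbd : ∀ (n : ℕ) (H : (Fin n → M × P) → M → PUnit.{v + 1} → B) (x : Fin (n + 1) → M × P)
      (m : M), bd (coindAct M ρ) n (fun y m => H y m PUnit.unit) x m =
        bd (coindAct M ρ') n H x m PUnit.unit := fun n H x m =>
    congr_fun (bd_map (coindAct M ρ') (coindAct M ρ) (MonoidHom.id _) g (fun _ _ => rfl) n H x) m
  have hop : ∀ (n : ℕ) (H : (Fin (n + 1) → M × P) → PUnit.{v + 1} → B) (x : Fin n → M × P)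
      (m : M), prismOp n (fun y => H y PUnit.unit) x m = prismOp n H x m PUnit.unit :=
    fun n H x m => prismOp_map (Pi.evalAddMonoidHom (fun _ => B) PUnit.unit) n H x m
  have := congr_fun (prismOp_bd_of_univ.{max a v} ρ' n (fun y m _ => F y m) x m) PUnit.unit
  rw [Pi.add_apply, Pi.sub_apply, ← hbd, ← hop] at this
  rw [← this]
  simp only [← hbd, ← hop]

end PrismHomotopy

end TopMonoidCohomology

namespace TopMonoidCohomology

/-! ### Systems of cochains -/

/-- A module over a monoid together with subgroups of the groups of inhomogeneous cochains which
are stable under the cosimplicial structure maps. -/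
structure CochainSystem (P : Type v) [Monoid P] (B : Type a) [AddCommGroup B] where
  /-- the action of the monoid -/
  act : P →* AddMonoid.End B
  /-- the admissible cochains -/
  cochains (n : ℕ) : AddSubgroup ((Fin n → P) → B)
  head_mem {n : ℕ} {f : (Fin n → P) → B} (hf : f ∈ cochains n) :
    (fun x : Fin (n + 1) → P => act (x 0) (f fun i => x i.succ)) ∈ cochains (n + 1)
  contract_mem {n : ℕ} {f : (Fin n → P) → B} (hf : f ∈ cochains n) (j : Fin (n + 1)) :
    (fun x => f (Fin.contractNth j (· * ·) x)) ∈ cochains (n + 1)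
  insert_mem {n : ℕ} {f : (Fin (n + 1) → P) → B} (hf : f ∈ cochains (n + 1)) (j : Fin (n + 1)) :
    (fun x : Fin n → P => f (j.insertNth (α := fun _ => P) 1 x)) ∈ cochains n

namespace CochainSystem

section Basic

variable {P : Type v} [Monoid P] {B : Type a} [AddCommGroup B] (S : CochainSystem P B)

lemma bd_mem {n : ℕ} {f : (Fin n → P) → B} (hf : f ∈ S.cochains n) :
    bd S.act n f ∈ S.cochains (n + 1) := by
  have : bd S.act n f = (fun x => S.act (x 0) (f fun i => x i.succ)) +
      ∑ j : Fin (n + 1), (-1 : ℤ) ^ ((j : ℕ) + 1) •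
        fun x => f (Fin.contractNth j (· * ·) x) := by
    ext x
    simp [bd, Finset.sum_apply]
  rw [this]
  exact add_mem (S.head_mem hf) (sum_mem fun j _ => zsmul_mem (S.contract_mem hf j) _)

/-- The boundary operator on admissible cochains. -/
def bdCochains (n : ℕ) : S.cochains n →+ S.cochains (n + 1) :=
  ((bd S.act n).comp (S.cochains n).subtype).codRestrict (S.cochains (n + 1))
    fun f => S.bd_mem f.2

/-- The complex of admissible cochains. -/
noncomputable def complex : CochainComplex AddCommGrpCat.{max a v} ℕ :=
  CochainComplex.of (fun n => AddCommGrpCat.of (S.cochains n))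
    (fun n => AddCommGrpCat.ofHom (S.bdCochains n)) fun n => by
      ext f : 2
      exact Subtype.ext (bd_bd S.act n f.1)

lemma complex_d (n : ℕ) : S.complex.d n (n + 1) = AddCommGrpCat.ofHom (S.bdCochains n) :=
  CochainComplex.of_d (fun n => AddCommGrpCat.of (S.cochains n))
    (fun n => AddCommGrpCat.ofHom (S.bdCochains n)) n

/-- The cohomology of a system of cochains. -/
noncomputable def cohomology : ℤ → AddCommGrpCat.{max a v}
  | Int.ofNat n => S.complex.homology n
  | Int.negSucc _ => AddCommGrpCat.of PUnit

end Basic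

section Map

variable {P Q : Type v} [Monoid P] [Monoid Q] {B B' : Type a} [AddCommGroup B] [AddCommGroup B']

/-- The map of complexes induced by compatible maps of monoids and of coefficients. -/
noncomputable def map (S : CochainSystem P B) (T : CochainSystem Q B')
    (α : Q →* P) (g : B →+ B') (h : ∀ q b, g (S.act (α q) b) = T.act q (g b))
    (hmem : ∀ n, ∀ f ∈ S.cochains n, (fun y => g (f fun i => α (y i))) ∈ T.cochains n) :
    S.complex ⟶ T.complex :=
  CochainComplex.ofHom (fun n => AddCommGrpCat.ofHom
    (AddMonoidHom.mk' (fun f : S.cochains n =>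
      (⟨fun y => g (f.1 fun i => α (y i)), hmem n f.1 f.2⟩ : T.cochains n))
      fun _ _ => Subtype.ext <| funext fun _ => map_add g _ _)) fun n => by
    rw [complex_d, complex_d]
    ext f : 2
    exact Subtype.ext <| funext fun x => bd_map S.act T.act α g h n f.1 x

/-- Systems of cochains which correspond to each other under a bijection of monoids have the same
cohomology. -/
lemma nonempty_cohomology_addEquiv (S : CochainSystem P B) (T : CochainSystem Q B) (e : Q ≃* P)
    (h : ∀ q b, S.act (e q) b = T.act q b)
    (hmem : ∀ n f, f ∈ S.cochains n ↔ (fun y => f fun i => e (y i)) ∈ T.cochains n) (n : ℤ) :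
    Nonempty (S.cohomology n ≃+ T.cohomology n) := by
  obtain n | n := n
  · let φ : S.complex ⟶ T.complex := map S T e.toMonoidHom (AddMonoidHom.id B) h
      fun n f hf => (hmem n f).1 hf
    let ψ : T.complex ⟶ S.complex := map T S e.symm.toMonoidHom (AddMonoidHom.id B)
      (fun q b => by simp [← h]) fun n f hf => by
        rw [hmem]
        simpa using hf
    have h1 : φ ≫ ψ = 𝟙 _ := by
      ext n f : 3
      refine Subtype.ext <| funext fun x => ?_
      exact congrArg f.1 (funext fun i => e.apply_symm_apply (x i))
    have h2 : ψ ≫ φ = 𝟙 _ := by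
      ext n f : 3
      refine Subtype.ext <| funext fun x => ?_
      exact congrArg f.1 (funext fun i => e.symm_apply_apply (x i))
    exact ⟨((HomologicalComplex.homologyFunctor _ _ n).mapIso
      ⟨φ, ψ, h1, h2⟩).addCommGroupIsoToAddEquiv⟩
  · exact ⟨AddEquiv.refl _⟩

end Map

section ULift

variable {P : Type v} [Monoid P] {B : Type a} [AddCommGroup B] (S : CochainSystem P B)

/-- Raising the universe level of the coefficients. -/
def uliftCoeff : CochainSystem P (ULift.{v} B) where
  act :=
    { toFun := fun p =>
        { toFun := fun b => ULift.up (S.act p b.down)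
          map_zero' := by simp; rfl
          map_add' := fun b c => by simp; rfl }
      map_one' := by
        ext b
        change S.act 1 b.down = b.down
        rw [map_one, AddMonoid.End.coe_one, id]
      map_mul' := fun p q => by
        ext b
        change S.act (p * q) b.down = S.act p (S.act q b.down)
        rw [map_mul]
        rfl }
  cochains n := (S.cochains n).comap
    { toFun := fun f x => (f x).down, map_zero' := rfl, map_add' := fun _ _ => rfl }
  head_mem hf := S.head_mem hf
  contract_mem hf := S.contract_mem hf
  insert_mem hf := S.insert_mem hf

/-- Raising the universe level of the coefficients does not change the cohomology. -/
lemma nonempty_cohomology_addEquiv_uliftCoeff (n : ℤ) :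
    Nonempty (S.cohomology n ≃+ S.uliftCoeff.cohomology n) := by
  obtain n | n := n
  · let φ : S.complex ⟶ S.uliftCoeff.complex :=
      CochainComplex.ofHom (fun n => AddCommGrpCat.ofHom
        (AddMonoidHom.mk' (fun f : S.cochains n =>
          (⟨fun y => ULift.up (f.1 y), f.2⟩ : S.uliftCoeff.cochains n))
          fun _ _ => rfl)) fun n => by
        rw [complex_d, complex_d]
        ext f : 2
        exact Subtype.ext <| funext fun x =>
          bd_map S.act S.uliftCoeff.act (MonoidHom.id _)
            (AddEquiv.ulift.symm : B ≃+ ULift.{v} B).toAddMonoidHom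
            (fun _ _ => rfl) n f.1 x
    let ψ : S.uliftCoeff.complex ⟶ S.complex :=
      CochainComplex.ofHom (fun n => AddCommGrpCat.ofHom
        (AddMonoidHom.mk' (fun f : S.uliftCoeff.cochains n =>
          (⟨fun y => (f.1 y).down, f.2⟩ : S.cochains n))
          fun _ _ => rfl)) fun n => by
        rw [complex_d, complex_d]
        ext f : 2
        exact Subtype.ext <| funext fun x =>
          bd_map S.uliftCoeff.act S.act (MonoidHom.id _)
            (AddEquiv.ulift : ULift.{v} B ≃+ B).toAddMonoidHom
            (fun _ _ => rfl) n f.1 x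
    exact ⟨((HomologicalComplex.homologyFunctor _ _ n).mapIso
      ⟨φ, ψ, by ext; rfl, by ext; rfl⟩).addCommGroupIsoToAddEquiv⟩
  · exact ⟨AddEquiv.refl _⟩

end ULift

/-! ### Cochains of a product with a discrete factor, trivial and coinduced coefficients -/

section Product

variable {P : Type v} [Monoid P] {B : Type a} [AddCommGroup B]

lemma contractNth_prod {M : Type*} [Monoid M] {n : ℕ} (j : Fin (n + 1)) (m : Fin (n + 1) → M)
    (p : Fin (n + 1) → P) : Fin.contractNth j (· * ·) (fun i => (m i, p i)) =
      fun i => (Fin.contractNth j (· * ·) m i, Fin.contractNth j (· * ·) p i) := by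
  ext i <;> simp only [Fin.contractNth] <;> split_ifs <;> rfl

lemma insertNth_prod {M : Type*} [Monoid M] {n : ℕ} (j : Fin (n + 1)) (m : Fin n → M)
    (p : Fin n → P) : j.insertNth (α := fun _ => M × P) 1 (fun i => (m i, p i)) =
      fun i => (j.insertNth (α := fun _ => M) 1 m i, j.insertNth (α := fun _ => P) 1 p i) := by
  funext i
  induction i using j.succAboveCases <;> simp [Prod.one_eq_mk]

/-- The cochains of `M × P`, where `M` acts trivially and is considered as discrete. -/
def prod (S : CochainSystem P B) (M : Type v) [Monoid M] : CochainSystem (M × P) B where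
  act := S.act.comp (MonoidHom.snd M P)
  cochains n :=
    { carrier := {f | ∀ m : Fin n → M, (fun p : Fin n → P => f fun i => (m i, p i)) ∈ S.cochains n}
      zero_mem' := fun _ => (S.cochains n).zero_mem
      add_mem' := fun hf hg m => (S.cochains n).add_mem (hf m) (hg m)
      neg_mem' := fun hf m => (S.cochains n).neg_mem (hf m) }
  head_mem hf m := S.head_mem (hf fun i => m i.succ)
  contract_mem hf j m := by
    simp only [contractNth_prod]
    exact S.contract_mem (hf _) j
  insert_mem hf j m := by
    simp only [insertNth_prod]
    exact S.insert_mem (hf _) j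

/-- The cochains of `M × P` with coefficients in the module of maps from the discrete monoid `M`
to a `P`-module. -/
def coind (S : CochainSystem P B) (M : Type v) [Monoid M] : CochainSystem (M × P) (M → B) where
  act := coindAct M S.act
  cochains n :=
    { carrier := {f | ∀ (m₀ : M) (m : Fin n → M),
        (fun p : Fin n → P => f (fun i => (m i, p i)) m₀) ∈ S.cochains n}
      zero_mem' := fun _ _ => (S.cochains n).zero_mem
      add_mem' := fun hf hg m₀ m => (S.cochains n).add_mem (hf m₀ m) (hg m₀ m)
      neg_mem' := fun hf m₀ m => (S.cochains n).neg_mem (hf m₀ m) }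
  head_mem hf m₀ m := S.head_mem (hf (m₀ * m 0) fun i => m i.succ)
  contract_mem hf j m₀ m := by
    simp only [contractNth_prod]
    exact S.contract_mem (hf m₀ _) j
  insert_mem hf j m₀ m := by
    simp only [insertNth_prod]
    exact S.insert_mem (hf m₀ _) j

/-- In the $P$-coordinates a prism simplex only inserts a $1$ at place $j$, and its $M$-coordinates
do not depend on the $P$-coordinates. Hence the prism operator preserves admissibility by
`insert_mem`. -/
lemma exists_prism_eq {M : Type*} [Monoid M] (n : ℕ) (j : Fin (n + 1)) (m : Fin n → M) (m₀ : M) :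
    ∃ w : Fin (n + 1) → M, ∀ p : Fin n → P, prism n j (fun i => (m i, p i)) m₀ =
      fun i => (w i, j.insertNth (α := fun _ => P) 1 p i) := by
  induction n generalizing m₀ with
  | zero =>
    refine ⟨fun _ => m₀, fun p => ?_⟩
    funext i
    obtain rfl : i = j := Subsingleton.elim (α := Fin 1) i j
    simp [prism]
  | succ n ih =>
    induction j using Fin.cases with
    | zero =>
      refine ⟨Fin.cons m₀ m, fun p => ?_⟩
      funext i
      rw [Fin.insertNth_zero']
      induction i using Fin.cases <;> simp [prism]
    | succ j =>
      obtain ⟨w, hw⟩ := ih j (fun i => m i.succ) (m₀ * m 0)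
      refine ⟨Fin.cons 1 w, fun p => ?_⟩
      funext i
      rw [← Fin.cons_self_tail p, Fin.insertNth_succ_cons]
      induction i using Fin.cases with
      | zero => simp [prism]
      | succ i => exact congr_fun (hw (Fin.tail p)) i

lemma prismOp_mem (S : CochainSystem P B) (M : Type v) [Monoid M] {n : ℕ}
    {f : (Fin (n + 1) → M × P) → M → B} (hf : f ∈ (S.coind M).cochains (n + 1)) :
    (prismOp n fun y => f y 1) ∈ (S.coind M).cochains n := by
  intro m₀ m
  choose w hw using fun j => exists_prism_eq (P := P) n j m m₀
  have : (fun p : Fin n → P => prismOp n (fun y => f y 1) (fun i => (m i, p i)) m₀) =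
      ∑ j : Fin (n + 1), (-1 : ℤ) ^ (j : ℕ) • fun p : Fin n → P =>
        f (fun i => (w j i, j.insertNth (α := fun _ => P) 1 p i)) 1 := by
    ext p
    simp [prismOp, hw]
  rw [this]
  exact sum_mem fun j _ => zsmul_mem (S.insert_mem (hf 1 (w j)) j) _

end Product

end CochainSystem

end TopMonoidCohomology

namespace TopMonoidCohomology

universe w

/-! ### Splitting of the long exact sequence -/

section Splitting

variable {K L N : CochainComplex AddCommGrpCat.{w} ℕ}

lemma homologyMap_inverse_of_homotopy (f : K ⟶ L) (u : N ⟶ K) (π : L ⟶ N)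
    (h₁ : u ≫ f ≫ π = 𝟙 N) (h₂ : Homotopy (π ≫ u ≫ f) (𝟙 L)) (n : ℕ) :
    (∀ x, HomologicalComplex.homologyMap π n
      (HomologicalComplex.homologyMap f n (HomologicalComplex.homologyMap u n x)) = x) ∧
    ∀ y, HomologicalComplex.homologyMap f n (HomologicalComplex.homologyMap u n
      (HomologicalComplex.homologyMap π n y)) = y := by
  have e₁ := congrArg (fun φ => HomologicalComplex.homologyMap φ n) h₁
  have e₂ := h₂.homologyMap_eq n
  simp only [HomologicalComplex.homologyMap_comp, HomologicalComplex.homologyMap_id] at e₁ e₂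
  exact ⟨fun x => ConcreteCategory.congr_hom e₁ x, fun y => ConcreteCategory.congr_hom e₂ y⟩

/-- In degree $0$ nothing precedes $H^0(K)$, so `f` remains injective on homology; as `u ≫ f` is
inverted by `π`, `u` is bijective there. -/
lemma nonempty_homology_zero_addEquiv
    (f : K ⟶ L) (g : L ⟶ L) (hfg : f ≫ g = 0)
    (hS : (ShortComplex.mk f g hfg).ShortExact) (u : N ⟶ K) (π : L ⟶ N) (h₁ : u ≫ f ≫ π = 𝟙 N)
    (h₂ : Homotopy (π ≫ u ≫ f) (𝟙 L)) : Nonempty (K.homology 0 ≃+ N.homology 0) := by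
  obtain ⟨e₁, e₂⟩ := homologyMap_inverse_of_homotopy f u π h₁ h₂ 0
  have : Mono (ShortComplex.mk f g hfg).f := hS.mono_f
  have : Mono f := this
  have hmono : Mono (HomologicalComplex.homologyMap f 0) :=
    HomologicalComplex.mono_homologyMap_of_mono_of_not_rel f 0 (by simp)
  rw [AddCommGrpCat.mono_iff_injective] at hmono
  refine ⟨AddEquiv.symm (AddEquiv.ofBijective (HomologicalComplex.homologyMap u 0).hom
    ⟨fun x y h => ?_, fun y => ⟨HomologicalComplex.homologyMap π 0
      (HomologicalComplex.homologyMap f 0 y), hmono ?_⟩⟩)⟩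
  · rw [← e₁ x, ← e₁ y]
    exact congrArg _ (congrArg _ h)
  · exact e₂ _

/-- All homology of `L` comes from `K` via `f`, so `g` induces zero. The long exact sequence breaks
into $0\to H^n(L)\to H^{n+1}(K)\to H^{n+1}(L)\to 0$. Here $H(L)\cong H(N)$, and `u` supplies a
section. -/
lemma nonempty_homology_succ_addEquiv
    (f : K ⟶ L) (g : L ⟶ L) (hfg : f ≫ g = 0)
    (hS : (ShortComplex.mk f g hfg).ShortExact) (u : N ⟶ K) (π : L ⟶ N) (h₁ : u ≫ f ≫ π = 𝟙 N)
    (h₂ : Homotopy (π ≫ u ≫ f) (𝟙 L)) (n : ℕ) :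
    Nonempty (K.homology (n + 1) ≃+ N.homology (n + 1) × N.homology n) := by
  obtain ⟨e₁, e₂⟩ := homologyMap_inverse_of_homotopy f u π h₁ h₂ (n + 1)
  obtain ⟨e₁', e₂'⟩ := homologyMap_inverse_of_homotopy f u π h₁ h₂ n
  have hij : (ComplexShape.up ℕ).Rel n (n + 1) := rfl
  have hfg' (n : ℕ) (x) : HomologicalComplex.homologyMap g n
      (HomologicalComplex.homologyMap f n x) = 0 := by
    have := congrArg (fun φ => HomologicalComplex.homologyMap φ n) hfg
    simp only [HomologicalComplex.homologyMap_comp, HomologicalComplex.homologyMap_zero] at this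
    exact ConcreteCategory.congr_hom this x
  have ex₁ := (ShortComplex.ab_exact_iff_function_exact _).1 (hS.homology_exact₁ n (n + 1) hij)
  have ex₃ := (ShortComplex.ab_exact_iff_function_exact _).1 (hS.homology_exact₃ n (n + 1) hij)
  -- The kernel of `δ` is the image of `g`, which vanishes because `g` is evaluated on classes of
  -- the form `f _`.
  have hδ : Function.Injective (hS.δ n (n + 1) hij) := by
    rw [injective_iff_map_eq_zero]
    intro y hy
    obtain ⟨z, rfl⟩ := (ex₃ y).1 hy
    rw [← e₂' z]
    exact hfg' n _
  let φ : N.homology (n + 1) × N.homology n →+ K.homology (n + 1) :=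
    AddMonoidHom.coprod (HomologicalComplex.homologyMap u (n + 1)).hom
      ((hS.δ n (n + 1) hij).hom.comp ((HomologicalComplex.homologyMap u n ≫
        HomologicalComplex.homologyMap f n).hom))
  have hφ (x y) : HomologicalComplex.homologyMap f (n + 1) (φ (x, y)) =
      HomologicalComplex.homologyMap f (n + 1) (HomologicalComplex.homologyMap u (n + 1) x) := by
    have : HomologicalComplex.homologyMap f (n + 1) (hS.δ n (n + 1) hij
      (HomologicalComplex.homologyMap f n (HomologicalComplex.homologyMap u n y))) = 0 :=
      (ex₁ _).2 ⟨_, rfl⟩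
    change HomologicalComplex.homologyMap f (n + 1) (_ + _) = _
    rw [map_add]
    erw [this]
    rw [add_zero]
    rfl
  refine ⟨(AddEquiv.ofBijective φ ⟨(injective_iff_map_eq_zero φ).2 ?_, ?_⟩).symm⟩
  · rintro ⟨x, y⟩ hxy
    have hx : x = 0 := by
      rw [← e₁ x, ← hφ x y, hxy, map_zero, map_zero]
    subst hx
    have hy : hS.δ n (n + 1) hij
        (HomologicalComplex.homologyMap f n (HomologicalComplex.homologyMap u n y)) = 0 := by
      rw [← hxy]
      change _ = HomologicalComplex.homologyMap u (n + 1) 0 + _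
      rw [map_zero, zero_add]
      rfl
    have := hδ (hy.trans (map_zero _).symm)
    rw [← e₁' y, this, map_zero]
    rfl
  · intro z
    let x := HomologicalComplex.homologyMap π (n + 1) (HomologicalComplex.homologyMap f (n + 1) z)
    have hz : HomologicalComplex.homologyMap f (n + 1)
        (z - HomologicalComplex.homologyMap u (n + 1) x) = 0 := by
      rw [map_sub, e₂, sub_self]
    obtain ⟨y, hy⟩ := (ex₁ _).1 hz
    refine ⟨(x, HomologicalComplex.homologyMap π n y), ?_⟩
    change HomologicalComplex.homologyMap u (n + 1) x + hS.δ n (n + 1) hij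
      (HomologicalComplex.homologyMap f n (HomologicalComplex.homologyMap u n
        (HomologicalComplex.homologyMap π n y))) = z
    rw [e₂']
    erw [hy]
    exact add_sub_cancel _ _

end Splitting

/-- A monoid which is freely generated by the element `t`, either as a monoid or as a group, in
the sense that every map from it to an abelian group has a primitive with respect to translation
by `t`, unique up to constants. -/
structure IsLine (M : Type v) [Monoid M] (t : M) : Prop where
  eq_const {B : Type (max a v)} (ψ : M → B) (h : ∀ m, ψ (t * m) = ψ m) (m : M) : ψ m = ψ 1
  exists_primitive {B : Type (max a v)} [AddCommGroup B] (φ : M → B) :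
    ∃ ψ : M → B, ∀ m, ψ (t * m) - ψ m = φ m

/-! ### The difference sequence for a monoid generated by one element -/

namespace CochainSystem

variable {P : Type v} [Monoid P] {B : Type max a v} [AddCommGroup B] (S : CochainSystem P B)
  {M : Type v} [Monoid M]

variable (M) in
/-- The inflation of cochains from `P` to `M × P`. -/
noncomputable def inflation : S.complex ⟶ (S.prod M).complex :=
  map S (S.prod M) (MonoidHom.snd M P) (AddMonoidHom.id B) (fun _ _ => rfl) fun _ _ hf _ => hf

variable (M) in
/-- The embedding of the coefficients as constant maps. -/
noncomputable def constMap : (S.prod M).complex ⟶ (S.coind M).complex :=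
  map (S.prod M) (S.coind M) (MonoidHom.id _)
    { toFun := fun b _ => b, map_zero' := rfl, map_add' := fun _ _ => rfl } (fun _ _ => rfl)
    fun _ _ hf _ m => hf m

/-- The difference operator on maps from `M`. -/
noncomputable def diffMap (t : M) : (S.coind M).complex ⟶ (S.coind M).complex :=
  map (S.coind M) (S.coind M) (MonoidHom.id _)
    { toFun := fun φ m => φ (t * m) - φ m
      map_zero' := by ext; simp
      map_add' := fun φ ψ => by ext; simp; abel }
    -- Equivariance: left translation by `t` commutes with the right translation through which `M`
    -- acts.
    (fun q φ => by
      ext m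
      change S.act q.2 (φ (t * m * q.1)) - S.act q.2 (φ (m * q.1)) =
        S.act q.2 (φ (t * (m * q.1)) - φ (m * q.1))
      rw [map_sub, mul_assoc])
    fun n f hf m₀ m => (S.cochains n).sub_mem (hf (t * m₀) m) (hf m₀ m)

variable (M) in
/-- Restriction to `P` and evaluation at the neutral element. -/
noncomputable def evalMap : (S.coind M).complex ⟶ S.complex :=
  map (S.coind M) S (MonoidHom.inr M P) (Pi.evalAddMonoidHom (fun _ => B) 1)
    (fun q φ => by
      change S.act q (φ (1 * 1)) = S.act q (φ 1)
      rw [mul_one])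
    fun _ _ hf => hf 1 fun _ => 1

lemma inflation_constMap_evalMap :
    S.inflation M ≫ S.constMap M ≫ S.evalMap M = 𝟙 S.complex := by
  ext n f : 3
  rfl

variable (M) in
/-- The prism operator on admissible cochains. -/
def prismHom (n : ℕ) : (S.coind M).cochains (n + 1) →+ (S.coind M).cochains n :=
  AddMonoidHom.mk' (fun f => ⟨prismOp n fun y => f.1 y 1, S.prismOp_mem M f.2⟩) fun f g => by
    refine Subtype.ext <| funext fun x => funext fun m => ?_
    simp [prismOp, Finset.sum_add_distrib]

variable (M) in
/-- The complex with coefficients in the coinduced module retracts to the complex for `P`. -/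
noncomputable def coindHomotopy :
    Homotopy (S.evalMap M ≫ S.inflation M ≫ S.constMap M) (𝟙 (S.coind M).complex) := by
  let h : ∀ i j, (ComplexShape.up ℕ).Rel j i →
      ((S.coind M).complex.X i ⟶ (S.coind M).complex.X j) := fun i j hij =>
    eqToHom (by rw [show i = j + 1 from hij.symm]; rfl) ≫ AddCommGrpCat.ofHom (S.prismHom M j)
  -- The prism formula, with degree $0$ separate because there the homotopy has only one summand.
  have key : 𝟙 _ - S.evalMap M ≫ S.inflation M ≫ S.constMap M = Homotopy.nullHomotopicMap' h := by
    ext n : 1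
    obtain _ | n := n
    · rw [Homotopy.nullHomotopicMap'_f_of_not_rel_right (k₁ := 0) (k₀ := 1) rfl (by simp)]
      simp only [h, complex_d]
      ext f : 2
      refine Subtype.ext <| funext fun x => funext fun m => ?_
      exact (prismOp_bd_zero S.act f.1 x m).symm
    · rw [Homotopy.nullHomotopicMap'_f (k₂ := n) (k₁ := n + 1) (k₀ := n + 2) rfl rfl]
      simp only [h, complex_d]
      ext f : 2
      refine Subtype.ext <| funext fun x => funext fun m => ?_
      exact (prismOp_bd S.act n f.1 x m).symm
  exact ((Homotopy.equivSubZero).symm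
    ((Homotopy.ofEq key).trans (Homotopy.nullHomotopy' h))).symm

variable {S} in
lemma constMap_diffMap {t : M} : S.constMap M ≫ S.diffMap t = 0 := by
  ext n f : 3
  exact Subtype.ext <| funext fun x => funext fun m => sub_self _

/-- Maps invariant under translation by `t` are constant, and every map is a difference. The latter
must be solved within admissible cochains. -/
lemma shortExact_of_isLine {t : M} (ht : IsLine.{a} M t) :
    (ShortComplex.mk (S.constMap M) (S.diffMap t) constMap_diffMap).ShortExact := by
  refine HomologicalComplex.shortExact_of_degreewise_shortExact _ fun n => ?_
  refine ShortComplex.ShortExact.mk' ?_ ?_ ?_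
  · rw [ShortComplex.ab_exact_iff]
    intro f hf
    have hf' : ∀ x m, f.1 x (t * m) = f.1 x m := fun x m =>
      sub_eq_zero.1 (congr_fun (congr_fun (congrArg Subtype.val hf) x) m)
    refine ⟨⟨fun x => f.1 x 1, fun m => f.2 1 m⟩, ?_⟩
    refine Subtype.ext <| funext fun x => funext fun m => ?_
    exact (ht.eq_const (f.1 x) (hf' x) m).symm
  · rw [AddCommGrpCat.mono_iff_injective]
    intro f g hfg
    refine Subtype.ext <| funext fun x => ?_
    exact congr_fun (congr_fun (congrArg Subtype.val hfg) x) (1 : M)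
  · rw [AddCommGrpCat.epi_iff_surjective]
    intro f
    -- For each fixed tuple of $M$-coordinates the primitive is taken with values in the group of
    -- admissible cochains of `P`, so admissibility of the solution is automatic.
    choose ψ hψ using fun m : Fin n → M => ht.exists_primitive (B := S.cochains n)
      fun m₀ => ⟨fun p => f.1 (fun i => (m i, p i)) m₀, f.2 m₀ m⟩
    refine ⟨⟨fun x m₀ => (ψ (fun i => (x i).1) m₀).1 fun i => (x i).2, fun m₀ m =>
      (ψ m m₀).2⟩, ?_⟩
    refine Subtype.ext <| funext fun x => funext fun m₀ => ?_
    exact congr_fun (congrArg Subtype.val (hψ (fun i => (x i).1) m₀)) fun i => (x i).2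

/-- The cohomology of `M × P` for a discrete monoid `M` generated by one element. -/
lemma nonempty_cohomology_prod_addEquiv {t : M} (ht : IsLine.{a} M t) (n : ℤ) :
    Nonempty ((S.prod M).cohomology n ≃+ S.cohomology n × S.cohomology (n - 1)) := by
  have hS := S.shortExact_of_isLine ht
  obtain (_ | n) | n := n
  · obtain ⟨e⟩ := nonempty_homology_zero_addEquiv _ _ _ hS _ _ S.inflation_constMap_evalMap
      (S.coindHomotopy M)
    -- The second factor lies in degree $-1$ and is therefore `PUnit`.
    exact ⟨e.trans (AddEquiv.prodUnique (M := S.complex.homology 0) (N := PUnit)).symm⟩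
  · obtain ⟨e⟩ := nonempty_homology_succ_addEquiv _ _ _ hS _ _ S.inflation_constMap_evalMap
      (S.coindHomotopy M) n
    rw [show Int.ofNat (n + 1) - 1 = Int.ofNat n by simp]
    exact ⟨e⟩
  · exact ⟨(AddEquiv.prodUnique (M := PUnit) (N := PUnit)).symm⟩

end CochainSystem

end TopMonoidCohomology

namespace TopMonoidCohomology

universe w

/-! ### Binomial direct sums -/

section Pascal

variable (H : ℤ → AddCommGrpCat.{w}) (E : ℕ → ℤ → AddCommGrpCat.{w})

/-- The groups with equal indices in a family are isomorphic. -/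
def indexCongr {i j : ℤ} (h : i = j) : H i ≃+ H j := h ▸ AddEquiv.refl _

/-- Records the summands by an index set with degrees instead of by binomial coefficients: each step
takes two copies of the set and raises the degrees on one by $1$. Counting elements of a given
degree is then Pascal's rule. -/
lemma exists_index_of_pascal (h₀ : ∀ n, Nonempty (E 0 n ≃+ H n))
    (hE : ∀ r n, Nonempty (E (r + 1) n ≃+ E r n × E r (n - 1))) (r : ℕ) :
    ∃ (U : Type) (_ : Finite U) (deg : U → ℕ),
      (∀ k, Nat.card {u // deg u = k} = r.choose k) ∧
      ∀ n, Nonempty (E r n ≃+ ∀ u, H (n - deg u)) := by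
  induction r with
  | zero =>
    refine ⟨Unit, inferInstance, fun _ => 0, fun k => ?_, fun n => ?_⟩
    · obtain _ | k := k <;> simp
    · obtain ⟨e⟩ := h₀ n
      exact ⟨(e.trans (indexCongr H (by simp))).trans
        (AddEquiv.piUnique fun _ : Unit => H (n - (0 : ℕ))).symm⟩
  | succ r ih =>
    obtain ⟨U, _, deg, hdeg, h⟩ := ih
    refine ⟨U ⊕ U, inferInstance, Sum.elim deg fun u => deg u + 1, fun k => ?_, fun n => ?_⟩
    · rw [Nat.card_congr Equiv.subtypeSum, Nat.card_sum]
      obtain _ | k := k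
      · simpa using hdeg 0
      · simpa [hdeg, Nat.choose_succ_succ] using add_comm _ _
    · obtain ⟨e⟩ := hE r n
      obtain ⟨e₁⟩ := h n
      obtain ⟨e₂⟩ := h (n - 1)
      have e₃ : (∀ u, H (n - 1 - deg u)) ≃+ ∀ u, H (n - (deg u + 1 : ℕ)) :=
        AddEquiv.piCongrRight fun u => indexCongr H (by push_cast; ring)
      exact ⟨(e.trans (e₁.prodCongr (e₂.trans e₃))).trans
        (LinearEquiv.sumPiEquivProdPi ℤ U U fun u =>
          H (n - (Sum.elim deg (fun u => deg u + 1) u : ℕ))).symm.toAddEquiv⟩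

/-- A family of groups satisfying Pascal's rule is given by binomial direct sums. -/
lemma nonempty_addEquiv_directSum_of_pascal (h₀ : ∀ n, Nonempty (E 0 n ≃+ H n))
    (hE : ∀ r n, Nonempty (E (r + 1) n ≃+ E r n × E r (n - 1))) (r : ℕ) (n : ℤ) :
    Nonempty (E r n ≃+ ⨁ k : Fin (r + 1), (Fin (r.choose k) → H (n - k))) := by
  obtain ⟨U, _, deg, hdeg, h⟩ := exists_index_of_pascal H E h₀ hE r
  obtain ⟨e⟩ := h n
  -- A degree above $r$ would have fibre of cardinality $\binom rk=0$. `Nat.card` also vanishes on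
  -- infinite types, so finiteness of `U` is needed.
  have hlt : ∀ u, deg u < r + 1 := by
    intro u
    by_contra hu
    have h1 := hdeg (deg u)
    rw [Nat.choose_eq_zero_of_lt (by omega), Nat.card_eq_zero] at h1
    obtain h1 | h1 := h1
    · exact h1.false ⟨u, rfl⟩
    · exact h1.not_finite inferInstance
  let q : U → Fin (r + 1) := fun u => ⟨deg u, hlt u⟩
  have c : ∀ k : Fin (r + 1), Nonempty (Fin (r.choose k) ≃ {u // q u = k}) := by
    intro k
    have : Nat.card {u // q u = k} = r.choose k := by
      rw [← hdeg k]
      exact Nat.card_congr (Equiv.subtypeEquivRight fun u => Fin.ext_iff)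
    rw [← this]
    exact ⟨(Finite.equivFin _).symm⟩
  let σ : (Σ k : Fin (r + 1), Fin (r.choose k)) ≃ U :=
    (Equiv.sigmaCongrRight fun k => (c k).some).trans (Equiv.sigmaFiberEquiv q)
  have hσ : ∀ p, deg (σ p) = p.1 := fun p => congrArg Fin.val ((c p.1).some p.2).2
  exact ⟨(e.trans (LinearEquiv.piCongrLeft' ℤ (fun u => H (n - deg u)) σ.symm).toAddEquiv).trans
    ((AddEquiv.piCongrRight fun p => indexCongr H (by rw [Equiv.symm_symm, hσ])).trans
      ((LinearEquiv.piCurry ℤ fun (k : Fin (r + 1)) (_ : Fin (r.choose k)) =>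
        H (n - k)).toAddEquiv.trans (DirectSum.addEquivProd _).symm))⟩

end Pascal

/-! ### Powers of a monoid generated by one element -/

namespace CochainSystem

variable {P : Type v} [Monoid P] {B : Type max a v} [AddCommGroup B] (S : CochainSystem P B)
  {L : Type v} [Monoid L]

variable (L P) in
/-- Splitting off the first factor of a power of a monoid. -/
def consMulEquiv (r : ℕ) : (Fin (r + 1) → L) × P ≃* L × ((Fin r → L) × P) where
  toFun x := (x.1 0, fun i => x.1 i.succ, x.2)
  invFun x := (Fin.cons x.1 x.2.1, x.2.2)
  left_inv x := by
    refine Prod.ext (funext fun i => ?_) rfl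
    induction i using Fin.cases <;> rfl
  right_inv _ := rfl
  map_mul' _ _ := rfl

/-- One factor `L` is split off at a time, the remaining power of `L` being treated as part of the
second monoid. -/
lemma nonempty_cohomology_prod_pow_addEquiv {t : L} (ht : IsLine.{a} L t) (r : ℕ) (n : ℤ) :
    Nonempty ((S.prod (Fin r → L)).cohomology n ≃+
      ⨁ k : Fin (r + 1), (Fin (r.choose k) → S.cohomology (n - k))) := by
  refine nonempty_addEquiv_directSum_of_pascal S.cohomology
    (fun r n => (S.prod (Fin r → L)).cohomology n) (fun n => ?_) (fun r n => ?_) r n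
  · refine nonempty_cohomology_addEquiv (S.prod (Fin 0 → L)) S (MulEquiv.uniqueProd).symm
      (fun _ _ => rfl) (fun n f => ?_) n
    refine ⟨fun hf => hf fun _ => default, fun hf m => ?_⟩
    rw [Subsingleton.elim m fun _ => default]
    exact hf
  · obtain ⟨e₁⟩ := nonempty_cohomology_addEquiv ((S.prod (Fin r → L)).prod L)
      (S.prod (Fin (r + 1) → L)) (consMulEquiv P L r) (fun _ _ => rfl)
      (fun n f => ⟨fun hf m => hf (fun i => m i 0) fun i j => m i j.succ,
        fun hf m m' => hf fun i => Fin.cons (m i) (m' i)⟩) n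
    obtain ⟨e₂⟩ := (S.prod (Fin r → L)).nonempty_cohomology_prod_addEquiv ht n
    exact ⟨e₁.symm.trans e₂⟩

end CochainSystem

lemma isLine_nat : IsLine.{a} (ULift.{v} (Multiplicative ℕ)) (ULift.up (Multiplicative.ofAdd 1)) where
  eq_const ψ h m := by
    obtain ⟨m⟩ := m
    induction m using Multiplicative.rec with | _ m =>
    induction m with
    | zero => rfl
    | succ m ih =>
      rw [add_comm]
      exact (h _).trans ih
  exists_primitive φ := by
    refine ⟨fun m => ∑ i ∈ Finset.range m.down.toAdd, φ (ULift.up (Multiplicative.ofAdd i)),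
      fun m => ?_⟩
    obtain ⟨m⟩ := m
    induction m using Multiplicative.rec with | _ m =>
    change ∑ i ∈ Finset.range (1 + m), _ - ∑ i ∈ Finset.range m, _ = _
    rw [add_comm, Finset.sum_range_succ, add_sub_cancel_left]

lemma isLine_int : IsLine.{a} (ULift.{v} (Multiplicative ℤ)) (ULift.up (Multiplicative.ofAdd 1)) where
  eq_const ψ h m := by
    obtain ⟨m⟩ := m
    induction m using Multiplicative.rec with | _ m =>
    induction m with
    | zero => rfl
    | succ m ih =>
      rw [add_comm]
      exact (h _).trans ih
    | pred m ih =>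
      rw [← ih, ← h]
      refine congrArg (fun k => ψ (ULift.up (Multiplicative.ofAdd k))) ?_
      change (1 : ℤ) + (-m - 1) = -m
      ring
  exists_primitive {B} _ φ := by
    -- The primitive vanishing at $0$: sums of `χ` over $[0,n)$ for $n\ge 0$, and minus the sum over
    -- $[n,0)$ for $n<0$.
    let χ : ℤ → B := fun i => φ (ULift.up (Multiplicative.ofAdd i))
    let ψ : ℤ → B
      | Int.ofNat n => ∑ i ∈ Finset.range n, χ i
      | Int.negSucc n => -∑ i ∈ Finset.range (n + 1), χ (Int.negSucc i)
    have hψ : ∀ m, ψ (1 + m) - ψ m = χ m := by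
      -- The case $-1$ is separate: adding $1$ there passes from one branch of `ψ` to the other.
      rintro (m | _ | m)
      · rw [show 1 + Int.ofNat m = Int.ofNat (m + 1) by simp [add_comm]]
        change ∑ i ∈ Finset.range (m + 1), _ - ∑ i ∈ Finset.range m, _ = _
        rw [Finset.sum_range_succ, add_sub_cancel_left]
        rfl
      · change ∑ i ∈ Finset.range 0, _ - -∑ i ∈ Finset.range 1, _ = _
        simp
      · rw [show 1 + Int.negSucc (m + 1) = Int.negSucc m by omega]
        change -∑ i ∈ Finset.range (m + 1), _ - -∑ i ∈ Finset.range (m + 1 + 1), _ = _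
        rw [Finset.sum_range_succ _ (m + 1)]
        abel
    exact ⟨fun m => ψ m.down.toAdd, fun m => hψ m.down.toAdd⟩

end TopMonoidCohomology

namespace TopMonoidCohomology

variable {C : Type u} [Category.{v} C] [CartesianMonoidalCategory C] [TopologicalCategory C]

/-! ### Points -/

lemma mapPts_ext_tensor {X Y : C} {z w : Pts (X ⊗ Y)}
    (h₁ : mapPts (fst X Y) z = mapPts (fst X Y) w) (h₂ : mapPts (snd X Y) z = mapPts (snd X Y) w) :
    z = w := by
  apply (ptsEquiv _).injective
  apply CartesianMonoidalCategory.hom_ext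
  · rw [← ptsEquiv_naturality, ← ptsEquiv_naturality, h₁]
  · rw [← ptsEquiv_naturality, ← ptsEquiv_naturality, h₂]

lemma exists_mapPts_tensor {X Y : C} (x : Pts X) (y : Pts Y) :
    ∃ z : Pts (X ⊗ Y), mapPts (fst X Y) z = x ∧ mapPts (snd X Y) z = y := by
  refine ⟨(ptsEquiv _).symm (lift (ptsEquiv X x) (ptsEquiv Y y)), ?_, ?_⟩
  · apply (ptsEquiv _).injective
    rw [ptsEquiv_naturality, Equiv.apply_symm_apply, lift_fst]
  · apply (ptsEquiv _).injective
    rw [ptsEquiv_naturality, Equiv.apply_symm_apply, lift_snd]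

lemma mapPts_constHom {X Y : C} (y : Pts Y) (x : Pts X) : mapPts (constHom X y) x = y := by
  apply (ptsEquiv _).injective
  rw [ptsEquiv_naturality, constHom, ← Category.assoc,
    pointIsTerminal.hom_ext (ptsEquiv X x ≫ pointIsTerminal.from X) (𝟙 _), Category.id_comp]

lemma mapPts_slice_fst {D X : C} (d : Pts D) (x : Pts X) :
    mapPts (fst D X) (mapPts (slice d X) x) = d := by
  rw [← mapPts_comp, slice, lift_fst, mapPts_constHom]

lemma mapPts_slice_snd {D X : C} (d : Pts D) (x : Pts X) :
    mapPts (snd D X) (mapPts (slice d X) x) = x := by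
  rw [← mapPts_comp, slice, lift_snd, mapPts_id]

lemma exists_coords {G : C} {n : ℕ} (x : Fin n → Pts G) :
    ∃ z : Pts (∏ᶜ fun _ : Fin n => G), RigidModule.coords z = x := by
  refine ⟨(ptsEquiv _).symm (Pi.lift fun i => ptsEquiv G (x i)), funext fun i => ?_⟩
  apply (ptsEquiv _).injective
  rw [RigidModule.coords, ptsEquiv_naturality, Equiv.apply_symm_apply, Limits.Pi.lift_π]

lemma mapPts_toUnit_one {G X : C} [MonObj G] (x : Pts X) :
    mapPts (toUnit X ≫ MonObj.one : X ⟶ G) x = 1 := by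
  apply (ptsEquiv G).injective
  rw [ptsEquiv_naturality, ptsEquiv_one, ← Category.assoc, comp_toUnit]
  rfl

/-- The points of a product of topologised monoids. -/
noncomputable def ptsTensorEquiv [BraidedCategory C] (D G : C) [MonObj D] [MonObj G] :
    Pts (D ⊗ G) ≃* Pts D × Pts G :=
  MulEquiv.ofBijective ((mapPtsHom (fst D G)).prod (mapPtsHom (snd D G)))
    ⟨fun _ _ h => mapPts_ext_tensor (congrArg Prod.fst h) (congrArg Prod.snd h), fun x => by
      obtain ⟨z, h₁, h₂⟩ := exists_mapPts_tensor x.1 x.2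
      exact ⟨z, Prod.ext h₁ h₂⟩⟩

/-! ### Pliant objects -/

namespace RigidModule

variable {G : C} [MonObj G] {A : RigidModule.{a} G}

/-- A function on $D'\times X$ is tested slicewise after pullback along `p`; pulling back along `i`
recovers it. -/
lemma IsPliant.of_retract {D D' : C} (hD : A.IsPliant D) (i : D' ⟶ D) (p : D ⟶ D')
    (hip : i ≫ p = 𝟙 D') : A.IsPliant D' := by
  intro X f
  refine ⟨fun hf d => A.comp_mem (slice d X) hf, fun hf => ?_⟩
  have h : (fun z => f (mapPts (p ▷ X) z)) ∈ A.h (D ⊗ X) := by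
    rw [hD]
    intro d
    convert hf (mapPts p d) using 3 with x
    apply mapPts_ext_tensor
    · rw [mapPts_slice_fst, ← mapPts_comp, whiskerRight_fst, mapPts_comp, mapPts_slice_fst]
    · rw [mapPts_slice_snd, ← mapPts_comp, whiskerRight_snd, mapPts_slice_snd]
  have h' := A.comp_mem (i ▷ X) h
  simpa only [← mapPts_comp, ← comp_whiskerRight, hip, id_whiskerRight, mapPts_id] using h'

lemma IsPliant.tensor {D D' : C} (hD : A.IsPliant D) (hD' : A.IsPliant D') :
    A.IsPliant (D ⊗ D') := by
  intro X f
  refine ⟨fun hf d => A.comp_mem (slice d X) hf, fun hf => ?_⟩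
  have h : (fun z => f (mapPts (α_ D D' X).inv z)) ∈ A.h (D ⊗ D' ⊗ X) := by
    rw [hD]
    intro d
    rw [hD']
    intro d'
    obtain ⟨e, he, he'⟩ := exists_mapPts_tensor d d'
    convert hf e using 3 with x
    apply mapPts_ext_tensor
    · apply mapPts_ext_tensor
      · rw [mapPts_slice_fst, he, ← mapPts_comp, ← mapPts_comp, associator_inv_fst_fst,
          mapPts_slice_fst]
      · rw [mapPts_slice_fst, he', ← mapPts_comp, ← mapPts_comp, associator_inv_fst_snd,
          mapPts_comp, mapPts_slice_snd, mapPts_slice_fst]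
    · rw [mapPts_slice_snd, ← mapPts_comp, associator_inv_snd, mapPts_comp, mapPts_slice_snd,
        mapPts_slice_snd]
  have h' := A.comp_mem (α_ D D' X).hom h
  simpa only [← mapPts_comp, Iso.hom_inv_id, mapPts_id] using h'

/-- The projection from $T\times X$ to `X` is undone by the only slice, so a function is the
pullback of its slice. -/
lemma isPliant_of_isTerminal {T : C} (hT : IsTerminal T) : A.IsPliant T := by
  intro X f
  refine ⟨fun hf d => A.comp_mem (slice d X) hf, fun hf => ?_⟩
  let d : Pts T := (ptsEquiv T).symm (hT.from _)
  have h := A.comp_mem (snd T X) (hf d)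
  have hd : snd T X ≫ slice d X = 𝟙 _ :=
    CartesianMonoidalCategory.hom_ext _ _ (hT.hom_ext _ _) (by simp [slice])
  simpa only [← mapPts_comp, hd, mapPts_id] using h

lemma IsPliant.pow {D : C} (hD : A.IsPliant D) (n : ℕ) : A.IsPliant (∏ᶜ fun _ : Fin n => D) := by
  induction n with
  | zero =>
    exact isPliant_of_isTerminal (IsTerminal.ofUniqueHom (fun X => Limits.Pi.lift fun i => i.elim0)
      fun X φ => Limits.Pi.hom_ext _ _ fun i => i.elim0)
  | succ n ih =>
    refine (hD.tensor ih).of_retract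
      (lift (Pi.π _ 0) (Pi.lift fun i : Fin n => Pi.π (fun _ : Fin (n + 1) => D) i.succ))
      (Pi.lift (Fin.cons (fst _ _) fun i => snd _ _ ≫ Pi.π (fun _ : Fin n => D) i)) ?_
    refine Limits.Pi.hom_ext _ _ fun i => ?_
    rw [Category.assoc, Limits.Pi.lift_π, Category.id_comp]
    induction i using Fin.cases with
    | zero => simp
    | succ i => simp

variable (A) in
/-- The system of inhomogeneous cochains of a module with rigidification. -/
noncomputable def system : CochainSystem (Pts G) A.carrier where
  act := A.act
  cochains := A.cochains
  head_mem {n f} hf := by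
    have h := A.comp_mem (lift (Pi.π (fun _ : Fin (n + 1) => G) 0)
      (Pi.lift fun i : Fin n => Pi.π (fun _ : Fin (n + 1) => G) i.succ)) (A.act_mem hf)
    simp only [← mapPts_comp, lift_fst, lift_snd] at h
    change (fun z => A.act (coords z 0) (f fun i => coords z i.succ)) ∈ A.h _
    convert h using 4
    · rfl
    funext i
    simp only [coords, ← mapPts_comp, Limits.Pi.lift_π]
  contract_mem {n f} hf j := by
    have h := A.comp_mem (Pi.lift fun k : Fin n => Fin.contractNth j
      (fun p q => lift p q ≫ MonObj.mul) (Pi.π (fun _ : Fin (n + 1) => G)) k) hf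
    change (fun z => f (Fin.contractNth j (· * ·) (coords z))) ∈ A.h _
    convert h using 3 with z
    ext k
    simp only [coords, ← mapPts_comp, Limits.Pi.lift_π, Fin.contractNth]
    split_ifs
    · rfl
    · rw [mapPts_lift_mul]
    · rfl
  insert_mem {n f} hf j := by
    have h := A.comp_mem (Pi.lift (j.insertNth (α := fun _ => (∏ᶜ fun _ : Fin n => G) ⟶ G)
      (constHom _ 1) (Pi.π (fun _ : Fin n => G)))) hf
    change (fun z => f (j.insertNth (α := fun _ => Pts G) 1 (coords z))) ∈ A.h _
    convert h using 3 with z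
    ext k
    simp only [coords, ← mapPts_comp, Limits.Pi.lift_π]
    induction k using j.succAboveCases <;> simp [mapPts_constHom, coords]

variable (A) in
-- The complexes of `A` and `A.system` agree by definition. The coefficients are lifted to `max a
-- v`, the universe that `IsLine` ranges over.
lemma nonempty_cohomology_addEquiv_system (n : ℤ) :
    Nonempty (A.cohomology n ≃+ A.system.uliftCoeff.cohomology n) := by
  obtain ⟨e⟩ := A.system.nonempty_cohomology_addEquiv_uliftCoeff n
  cases n <;> exact ⟨e⟩

end RigidModule

/-! ### Reduction from topologised monoids to systems of cochains -/

section Product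

variable [BraidedCategory C] {D G : C} [MonObj D] [MonObj G] {A : RigidModule.{a} (D ⊗ G)}

/-- The cochains of `D × G` are the maps from powers of `D` to the cochains of `G`. -/
lemma mem_cochains_tensor_iff (hDA : A.IsPliant D) (n : ℕ)
    (f : (Fin n → Pts (D ⊗ G)) → A.carrier) :
    f ∈ A.cochains n ↔ ∀ m : Fin n → Pts D,
      (fun p : Fin n → Pts G => f fun i => (ptsTensorEquiv D G).symm (m i, p i)) ∈
        (A.restrict (inrHom D G)).cochains n := by
  let θ : (∏ᶜ fun _ : Fin n => D) ⊗ (∏ᶜ fun _ : Fin n => G) ⟶ ∏ᶜ fun _ : Fin n => D ⊗ G :=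
    Limits.Pi.lift fun i => lift (fst _ _ ≫ Pi.π (fun _ : Fin n => D) i)
      (snd _ _ ≫ Pi.π (fun _ : Fin n => G) i)
  let θ' : (∏ᶜ fun _ : Fin n => D ⊗ G) ⟶ (∏ᶜ fun _ : Fin n => D) ⊗ (∏ᶜ fun _ : Fin n => G) :=
    lift (Limits.Pi.lift fun i => Pi.π (fun _ : Fin n => D ⊗ G) i ≫ fst D G)
      (Limits.Pi.lift fun i => Pi.π (fun _ : Fin n => D ⊗ G) i ≫ snd D G)
  -- One composite suffices: pullback along `θ` and then `θ'` returns the original function, so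
  -- admissibility passes in both directions.
  have hθ : θ' ≫ θ = 𝟙 _ := by
    refine Limits.Pi.hom_ext _ _ fun i => ?_
    apply CartesianMonoidalCategory.hom_ext <;> simp [θ, θ']
  have h₁ : f ∈ A.cochains n ↔ (fun z => f (RigidModule.coords (mapPts θ z))) ∈
      A.h ((∏ᶜ fun _ : Fin n => D) ⊗ ∏ᶜ fun _ : Fin n => G) := by
    refine ⟨fun hf => A.comp_mem θ hf, fun hf => ?_⟩
    have h := A.comp_mem θ' hf
    simp only [← mapPts_comp, hθ, mapPts_id] at h
    exact h
  have h₂ : ∀ (d : Pts (∏ᶜ fun _ : Fin n => D)) (z : Pts (∏ᶜ fun _ : Fin n => G)),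
      RigidModule.coords (mapPts θ (mapPts (slice d _) z)) = fun i =>
        (ptsTensorEquiv D G).symm (RigidModule.coords d i, RigidModule.coords z i) := by
    intro d z
    funext i
    rw [MulEquiv.eq_symm_apply]
    refine Prod.ext ?_ ?_
    · change mapPts (fst D G) (mapPts (Pi.π (fun _ : Fin n => D ⊗ G) i) _) = _
      rw [← mapPts_comp, ← mapPts_comp, Limits.Pi.lift_π_assoc, lift_fst, mapPts_comp,
        mapPts_slice_fst]
      rfl
    · change mapPts (snd D G) (mapPts (Pi.π (fun _ : Fin n => D ⊗ G) i) _) = _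
      rw [← mapPts_comp, ← mapPts_comp, Limits.Pi.lift_π_assoc, lift_snd, mapPts_comp,
        mapPts_slice_snd]
      rfl
  rw [h₁, hDA.pow n]
  simp only [h₂]
  constructor
  · intro hf m
    obtain ⟨d, rfl⟩ := exists_coords m
    exact hf d
  · intro hf d
    exact hf (RigidModule.coords d)

/-- Because $(d,g)=(d,1)(1,g)$ and $(d,1)$ acts trivially. -/
lemma act_eq_act_inrHom
    (htriv : ∀ (d : Pts D) (x : A.carrier), A.act (mapPts (inlHom D G) d) x = x)
    (z : Pts (D ⊗ G)) (x : A.carrier) :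
    A.act z x = A.act (mapPts (inrHom D G) (mapPts (snd D G) z)) x := by
  have hz : z = mapPts (inlHom D G) (mapPts (fst D G) z) *
      mapPts (inrHom D G) (mapPts (snd D G) z) := by
    apply mapPts_ext_tensor
    · refine Eq.trans ?_ (map_mul (mapPtsHom (fst D G)) _ _).symm
      change _ = mapPts (fst D G) _ * mapPts (fst D G) _
      rw [← mapPts_comp, ← mapPts_comp (inrHom D G), inlHom, inrHom, lift_fst, lift_fst,
        mapPts_id, mapPts_toUnit_one, mul_one]
    · refine Eq.trans ?_ (map_mul (mapPtsHom (snd D G)) _ _).symm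
      change _ = mapPts (snd D G) _ * mapPts (snd D G) _
      rw [← mapPts_comp, ← mapPts_comp (inrHom D G), inlHom, inrHom, lift_snd, lift_snd,
        mapPts_id, mapPts_toUnit_one, one_mul]
  conv_lhs => rw [hz, map_mul]
  exact htriv _ _

lemma nonempty_cohomology_addEquiv_of_isLine (hDA : A.IsPliant D)
    (htriv : ∀ (d : Pts D) (x : A.carrier), A.act (mapPts (inlHom D G) d) x = x)
    {L : Type v} [Monoid L] {t : L} (ht : IsLine.{a} L t) (r : ℕ) (e : Pts D ≃* (Fin r → L))
    (n : ℤ) :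
    Nonempty (A.cohomology n ≃+ ⨁ k : Fin (r + 1), (Fin (r.choose k) →
      (A.restrict (inrHom D G)).cohomology (n - k))) := by
  let S := (A.restrict (inrHom D G)).system.uliftCoeff
  obtain ⟨e₁⟩ := A.nonempty_cohomology_addEquiv_system n
  obtain ⟨e₂⟩ := CochainSystem.nonempty_cohomology_addEquiv A.system.uliftCoeff
    (S.prod (Fin r → L)) ((e.symm.prodCongr (MulEquiv.refl _)).trans (ptsTensorEquiv D G).symm)
    (fun q b => by
      refine congrArg ULift.up ((act_eq_act_inrHom htriv _ _).trans ?_)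
      have h := congrArg Prod.snd ((ptsTensorEquiv D G).apply_symm_apply (e.symm q.1, q.2))
      exact congrArg (fun p => A.act (mapPts (inrHom D G) p) b.down) h)
    (fun n f => by
      refine (mem_cochains_tensor_iff hDA n _).trans ?_
      refine ⟨fun hf m => hf fun i => e.symm (m i), fun hf m => ?_⟩
      have h := hf fun i => e (m i)
      change (fun p : Fin n → Pts G => (f fun i => (ptsTensorEquiv D G).symm
        (e.symm (e (m i)), p i)).down) ∈ (A.restrict (inrHom D G)).cochains n at h
      simp only [MulEquiv.symm_apply_apply] at h
      exact h) n
  obtain ⟨e₃⟩ := S.nonempty_cohomology_prod_pow_addEquiv ht r n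
  have e₄ := fun k : ℤ =>
    (A.restrict (inrHom D G)).nonempty_cohomology_addEquiv_system k
  have e₅ : (⨁ k : Fin (r + 1), (Fin (r.choose k) → S.cohomology (n - k))) ≃+
      ⨁ k : Fin (r + 1), (Fin (r.choose k) →
        (A.restrict (inrHom D G)).cohomology (n - k)) :=
    DFinsupp.mapRange.addEquiv fun k => AddEquiv.piCongrRight fun _ => (e₄ (n - k)).some.symm
  exact ⟨(e₁.trans e₂).trans (e₃.trans e₅)⟩

end Product

end TopMonoidCohomology

open TopMonoidCohomology in
theorem proposition11p18 {C : Type u} [Category.{v} C] [CartesianMonoidalCategory C]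
    [BraidedCategory C] [TopologicalCategory C] (D G : C) [MonObj D] [MonObj G]
    (A : RigidModule.{a} (D ⊗ G)) (hD : IsDiscrete D) (hDA : A.IsPliant D)
    (htriv : ∀ (d : Pts D) (x : A.carrier), A.act (mapPts (inlHom D G) d) x = x)
    (r : ℕ)
    (hr : Nonempty (Pts D ≃* Multiplicative (Fin r → ℕ)) ∨
      Nonempty (Pts D ≃* Multiplicative (Fin r → ℤ)))
    (n : ℤ) :
    Nonempty (A.cohomology n ≃+
      ⨁ k : Fin (r + 1), (Fin (r.choose k) → (A.restrict (inrHom D G)).cohomology (n - k))) := by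
  obtain ⟨⟨e⟩⟩ | ⟨⟨e⟩⟩ := hr
  · refine nonempty_cohomology_addEquiv_of_isLine hDA htriv isLine_nat r (e.trans ?_) n
    -- A power of the additive monoid is rewritten as a power of its multiplicative form, lifted to
    -- the universe of `Pts D`.
    exact
      { toFun := fun x i => ULift.up (Multiplicative.ofAdd (x.toAdd i))
        invFun := fun x => Multiplicative.ofAdd fun i => (x i).down.toAdd
        left_inv := fun _ => rfl
        right_inv := fun _ => rfl
        map_mul' := fun _ _ => rfl }
  · refine nonempty_cohomology_addEquiv_of_isLine hDA htriv isLine_int r (e.trans ?_) n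
    exact
      { toFun := fun x i => ULift.up (Multiplicative.ofAdd (x.toAdd i))
        invFun := fun x => Multiplicative.ofAdd fun i => (x i).down.toAdd
        left_inv := fun _ => rfl
        right_inv := fun _ => rfl
        map_mul' := fun _ _ => rfl }
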